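/- Let $\Omega\subset\mathbb R^2$ be a polygonal domain, i.e. a nonempty bounded connected open set whose boundary is a finite union of line segments. A polygonal mesh of $\Omega$ consists of a finite family $\mathcal T$ of pairwise disjoint open polygons $K\subset\Omega$ (the control volumes), points $x_K\in K$ such that $K$ is star-shaped with respect to $x_K$ (for instance, $K$ convex), and a finite family $\mathcal E=\mathcal E_{\rm int}\cup\mathcal E_{\rm ext}$ of nondegenerate segments (the edges), such that the closure of $\bigcup_{K\in\mathcal T}K$ is $\overline\Omega$; the boundary of each $K\in\mathcal T$ is the union of a subfamily $\mathcal E_K$ of $\mathcal E$; each $\sigma\in\mathcal E_{\rm int}$ has its relative interior in $\Omega$ and belongs to $\mathcal E_K$ for exactly two control volumes, $K$ and $L$, which is written $\sigma=K|L$; each $\sigma\in\mathcal E_{\rm ext}$ lies in $\partial\Omega$ and belongs to $\mathcal E_K$ for exactly one $K$; distinct interior edges, as well as distinct boundary edges of the same control volume, have disjoint relative interiors. (The segment $[x_K,x_L]$ need not be orthogonal to $K|L$.) Write ${\rm m}_K$ for the area of $K$, ${\rm m}_\sigma$ for the length of $\sigma$, $d(x_K,\sigma)$ for the Euclidean distance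 from $x_K$ to the line containing $\sigma$, ${\rm d}_\sigma=|x_K-x_L|$ if $\sigma=K|L\in\mathcal E_{\rm int}$, ${\rm d}_\sigma=d(x_K,\sigma)$ if $\sigma\in\mathcal E_{\rm ext}\cap\mathcal E_K$, and $\tau_\sigma={\rm m}_\sigma/{\rm d}_\sigma$ for $\sigma\in\mathcal E_{\rm int}$. The mesh satisfies the regularity constraint with parameter $\zeta>0$ if $d(x_K,\sigma)\ge\zeta\,{\rm d}_\sigma$ for all $K\in\mathcal T$ and $\sigma\in\mathcal E_K$. **Theorem.** There are constants $C_{PW}>0$, $C_B>0$ and $C_{LS}>0$ depending only on $\Omega$, with $C_B=C_{PW}$, such that for every polygonal mesh of $\Omega$ satisfying the regularity constraint with parameter $\zeta>0$ and all $(\mu_K)_{K\in\mathcal T}$ with $\mu_K\ge0$ and $\sum_{K\in\mathcal T}{\rm m}_K\mu_K=1$, the following holds with $\mu^\infty=\sup_{K\in\mathcal T}\mu_K$. (i) For all real $(f_K)_{K\in\mathcal T}$, $$\sum_{K\in\mathcal T}{\rm m}_K\Big|f_K-\sum_{\tilde K\in\mathcal T}{\rm m}_{\tilde K}f_{\tilde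 K}\mu_{\tilde K}\Big|^2\mu_K\le\frac{C_{PW}}{\zeta}\,\mu^\infty\sum_{\sigma=K|L\in\mathcal E_{\rm int}}\tau_\sigma|f_K-f_L|^2 .$$ (ii) For all $p\in(1,2]$ and all $(f_K)_{K\in\mathcal T}$ with $f_K\ge0$, $$\sum_{K\in\mathcal T}{\rm m}_Kf_K^2\mu_K-\Big(\sum_{K\in\mathcal T}{\rm m}_Kf_K^{2/p}\mu_K\Big)^p\le\frac{C_B}{\zeta}\,\mu^\infty\sum_{\sigma=K|L\in\mathcal E_{\rm int}}\tau_\sigma|f_K-f_L|^2 .$$ (iii) For all $(f_K)_{K\in\mathcal T}$ with $f_K>0$, $$\sum_{K\in\mathcal T}{\rm m}_Kf_K^2\log\left(\frac{f_K^2}{\sum_{\tilde K\in\mathcal T}{\rm m}_{\tilde K}f_{\tilde K}^2\mu_{\tilde K}}\right)\mu_K\le\frac{C_{LS}}{\zeta^2}\sqrt{\mu^\infty}\sum_{\sigma=K|L\in\mathcal E_{\rm int}}\tau_\sigma|f_K-f_L|^2 .$$ -/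

import Mathlib

open MeasureTheory

noncomputable section

/-- The Euclidean plane. -/
abbrev Plane : Type := EuclideanSpace ℝ (Fin 2)

/-- A polygonal domain: a bounded connected (nonempty) open subset of the plane whose boundary is
a finite union of line segments. -/
structure IsPolygonalDomain (Ω : Set Plane) : Prop where
  isOpen : IsOpen Ω
  isConnected : IsConnected Ω
  isBounded : Bornology.IsBounded Ω
  polygonal : ∃ S : Finset (Plane × Plane), frontier Ω = ⋃ s ∈ S, segment ℝ s.1 s.2

/-- The closed segment joining the two points of a pair. -/
def edgeSet (e : Plane × Plane) : Set Plane := segment ℝ e.1 e.2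

/-- The relative interior of the segment joining the two points of a pair. -/
def edgeInterior (e : Plane × Plane) : Set Plane := openSegment ℝ e.1 e.2

/-- The one-dimensional Hausdorff measure of an edge. -/
def edgeLength (e : Plane × Plane) : ℝ := (Measure.hausdorffMeasure 1 (edgeSet e)).toReal

theorem edgeLength_eq_dist (e : Plane × Plane) : edgeLength e = dist e.1 e.2 := by
  rw [edgeLength, edgeSet, hausdorffMeasure_segment, edist_dist,
    ENNReal.toReal_ofReal dist_nonneg]

/-- The Euclidean distance from a point to the straight line that contains an edge. -/
def distToEdgeLine (x : Plane) (e : Plane × Plane) : ℝ :=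
  Metric.infDist x (affineSpan ℝ {e.1, e.2} : Set Plane)

/-- A polygonal mesh of `Ω`. The index types are `T` for the control volumes, `Eint` for the
interior edges and `Eext` for the boundary edges. An interior edge `σ = K|L` has the two adjacent
control volumes `left σ = K` and `right σ = L` (the order is immaterial), a boundary edge has the
unique adjacent control volume `owner σ`. No orthogonality condition is imposed.

The control volumes are open polygons, star-shaped with respect to their centres. This holds in
particular if they are convex. -/
structure PolygonalMesh (Ω : Set Plane) (T Eint Eext : Type*) where
  /-- the control volumes -/
  cell : T → Set Plane
  /-- the centres `x_K` -/
  center : T → Plane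
  /-- the end points of the interior edges -/
  intEdge : Eint → Plane × Plane
  /-- the end points of the boundary edges -/
  extEdge : Eext → Plane × Plane
  left : Eint → T
  right : Eint → T
  owner : Eext → T
  isOpen_cell : ∀ K, IsOpen (cell K)
  cell_subset : ∀ K, cell K ⊆ Ω
  center_mem : ∀ K, center K ∈ cell K
  starConvex_cell : ∀ K, StarConvex ℝ (center K) (cell K)
  disjoint_cell : ∀ K L, K ≠ L → Disjoint (cell K) (cell L)
  closure_iUnion_cell : closure (⋃ K, cell K) = closure Ω
  left_ne_right : ∀ σ, left σ ≠ right σ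
  intEdge_nondegenerate : ∀ σ, (intEdge σ).1 ≠ (intEdge σ).2
  extEdge_nondegenerate : ∀ σ, (extEdge σ).1 ≠ (extEdge σ).2
  intEdge_subset : ∀ σ, edgeInterior (intEdge σ) ⊆ Ω
  extEdge_subset : ∀ σ, edgeSet (extEdge σ) ⊆ frontier Ω
  disjoint_intEdge : ∀ σ σ', σ ≠ σ' →
    Disjoint (edgeInterior (intEdge σ)) (edgeInterior (intEdge σ'))
  disjoint_extEdge : ∀ σ σ', σ ≠ σ' → owner σ = owner σ' →
    Disjoint (edgeInterior (extEdge σ)) (edgeInterior (extEdge σ'))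
  /-- the boundary of a control volume is the union of its edges -/
  frontier_cell : ∀ K, frontier (cell K) =
    (⋃ σ ∈ {σ | left σ = K ∨ right σ = K}, edgeSet (intEdge σ)) ∪
      ⋃ σ ∈ {σ | owner σ = K}, edgeSet (extEdge σ)

namespace PolygonalMesh

variable {Ω : Set Plane} {T Eint Eext : Type*}

/-- The Lebesgue measure `m_K` of a control volume. -/
def area (M : PolygonalMesh Ω T Eint Eext) (K : T) : ℝ := (volume (M.cell K)).toReal

/-- `d_σ = d(x_K, x_L)` for an interior edge `σ = K|L`. -/
def intDist (M : PolygonalMesh Ω T Eint Eext) (σ : Eint) : ℝ :=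
  dist (M.center (M.left σ)) (M.center (M.right σ))

/-- `d_σ = d(x_K, σ)` for a boundary edge `σ` of `K`. -/
def extDist (M : PolygonalMesh Ω T Eint Eext) (σ : Eext) : ℝ :=
  distToEdgeLine (M.center (M.owner σ)) (M.extEdge σ)

/-- The transmissibility `τ_σ = m_σ / d_σ` of an interior edge. -/
def trans (M : PolygonalMesh Ω T Eint Eext) (σ : Eint) : ℝ :=
  edgeLength (M.intEdge σ) / M.intDist σ

/-- The regularity constraint: `d(x_K, σ) ≥ ζ d_σ` for every control volume `K` and every edge `σ`
of `K`. -/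
def IsRegular (M : PolygonalMesh Ω T Eint Eext) (ζ : ℝ) : Prop :=
  (∀ σ : Eint, ∀ K : T, (M.left σ = K ∨ M.right σ = K) →
      ζ * M.intDist σ ≤ distToEdgeLine (M.center K) (M.intEdge σ)) ∧
    ∀ σ : Eext, ∀ K : T, M.owner σ = K →
      ζ * M.extDist σ ≤ distToEdgeLine (M.center K) (M.extEdge σ)

/-- The squared discrete `H¹` seminorm: the sum of `τ_σ |f_K - f_L|²` over the interior edges
`σ = K|L`. -/
def energy [Fintype Eint] (M : PolygonalMesh Ω T Eint Eext) (f : T → ℝ) : ℝ :=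
  ∑ σ, M.trans σ * |f (M.left σ) - f (M.right σ)| ^ 2

/-- The mean value of a discrete function with respect to the discrete density `μ`. -/
def mean [Fintype T] (M : PolygonalMesh Ω T Eint Eext) (μ f : T → ℝ) : ℝ :=
  ∑ K, M.area K * f K * μ K

/-- A discrete probability density. -/
structure IsDensity [Fintype T] (M : PolygonalMesh Ω T Eint Eext) (μ : T → ℝ) : Prop where
  nonneg : ∀ K, 0 ≤ μ K
  mass : ∑ K, M.area K * μ K = 1

end PolygonalMesh

end

/-!
The three inequalities rest on one estimate in which neither the density nor the regularity of the
mesh occurs: for a polygonal domain `Ω` there is a constant `C` such that every discrete function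
`f` on every mesh has a constant `c` with `∑ m_K |f_K - c|² ≤ C (∑ m_σ |f_K - f_L|)²`
(`IsPolygonalDomain.sobolevPoincare`), the embedding of `BV` into `L²` in dimension two.

On a parallelogram in `Ω` it follows from the Gagliardo-Nirenberg argument
(`sobolevPoincare_parallelogram`): along a line that avoids the vertices, `f` changes by at most the
sum of the jumps across the edges that the line meets (`abs_sub_le_lineVariation`), because a point
of `Ω` that is no vertex touches at most the two neighbours of one edge
(`exists_edge_of_mem_closure`). The inequality passes to the union of two overlapping sets
(`SobolevPoincare.union`). Near each point, a polygonal domain is a union of sectors, hence of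
parallelograms up to a null set (`exists_local_parallelogram_cover`); compactness gives a finite
cover of `Ω`, and connectedness provides the overlaps (`sobolevPoincare_of_ae_cover`).

The regularity constraint enters through `IsRegular.sum_edgeLength_mul_intDist_le`: the triangles
over the interior edges of a control volume do not overlap, so that sums of `m_σ d_σ` are bounded by
areas divided by `ζ`. By the Cauchy-Schwarz inequality the squared variation of `f` is then at most
a constant times `ζ⁻¹` times the energy of `f`. This bounds `f - c` in `L²`; the estimate for
`(f - c)²` in place of `f` bounds it in `L⁴` (`IsPolygonalDomain.exists_sum_area_le`).

The density is bounded by its supremum. The first inequality follows since the mean minimises the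
`L²` distance to constants, and the second one since the mean is at most the `L^{2/p}` norm. For the
third one, the entropy of `f²` with respect to a probability measure is at most ten times the
squared `L⁴` distance of `f` to any constant (`entropy_le_sqrt_sum_pow_four`), which is where the
square root of the supremum comes from; `ζ⁻¹ ≤ ζ⁻²` holds whenever there is an interior edge
(`IsRegular.le_one`).
-/

/-! ### Cross products, parallelograms and null sets in the plane -/

/-- The wedge product `u₀ v₁ - u₁ v₀` of two vectors of the plane, i.e. their oriented area. -/
def wedge (u v : Plane) : ℝ := u 0 * v 1 - u 1 * v 0

theorem wedge_add_right (u v w : Plane) : wedge u (v + w) = wedge u v + wedge u w := by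
  simp only [wedge, PiLp.add_apply]; ring

theorem wedge_add_left (u v w : Plane) : wedge (u + v) w = wedge u w + wedge v w := by
  simp only [wedge, PiLp.add_apply]; ring

theorem wedge_smul_right (c : ℝ) (u v : Plane) : wedge u (c • v) = c * wedge u v := by
  simp only [wedge, PiLp.smul_apply, smul_eq_mul]; ring

theorem wedge_smul_left (c : ℝ) (u v : Plane) : wedge (c • u) v = c * wedge u v := by
  simp only [wedge, PiLp.smul_apply, smul_eq_mul]; ring

theorem wedge_self (u : Plane) : wedge u u = 0 := by
  simp only [wedge]; ring

theorem wedge_comm (u v : Plane) : wedge u v = -wedge v u := by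
  simp only [wedge]; ring

/-- Cramer's rule in the plane. -/
theorem eq_smul_add_smul_of_wedge_ne_zero {u v : Plane} (h : wedge u v ≠ 0) (z : Plane) :
    z = (wedge z v / wedge u v) • u + (wedge u z / wedge u v) • v := by
  ext i
  fin_cases i
  · simp only [PiLp.add_apply, PiLp.smul_apply, smul_eq_mul, Fin.zero_eta]
    rw [div_mul_eq_mul_div, div_mul_eq_mul_div, ← add_div, eq_div_iff h]
    simp only [wedge]
    ring
  · simp only [PiLp.add_apply, PiLp.smul_apply, smul_eq_mul, Fin.mk_one]
    rw [div_mul_eq_mul_div, div_mul_eq_mul_div, ← add_div, eq_div_iff h]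
    simp only [wedge]
    ring

/-- The coordinates with respect to two linearly independent vectors of the plane. -/
noncomputable def wedgeEquiv (u v : Plane) (h : wedge u v ≠ 0) : Plane ≃L[ℝ] ℝ × ℝ :=
  LinearEquiv.toContinuousLinearEquiv
    { toFun := fun z => (wedge z v / wedge u v, wedge u z / wedge u v)
      map_add' := fun x y => by
        simp only [wedge_add_left, wedge_add_right, add_div, Prod.mk_add_mk]
      map_smul' := fun c x => by
        simp only [wedge_smul_left, wedge_smul_right, mul_div_assoc, RingHom.id_apply,
          Prod.smul_mk, smul_eq_mul]
      invFun := fun p => p.1 • u + p.2 • v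
      left_inv := fun z => (eq_smul_add_smul_of_wedge_ne_zero h z).symm
      right_inv := fun p => by
        ext <;>
          simp [wedge_add_left, wedge_add_right, wedge_smul_left, wedge_smul_right, wedge_self, h] }

theorem wedgeEquiv_apply (u v : Plane) (h : wedge u v ≠ 0) (z : Plane) :
    wedgeEquiv u v h z = (wedge z v / wedge u v, wedge u z / wedge u v) := rfl

theorem wedgeEquiv_smul_add_smul (u v : Plane) (h : wedge u v ≠ 0) (s t : ℝ) :
    wedgeEquiv u v h (s • u + t • v) = (s, t) :=
  (wedgeEquiv u v h).apply_symm_apply (s, t)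

/-- The open parallelogram with corner `x` and sides `r • u` and `r • v`. -/
def parallelogram (x u v : Plane) (r : ℝ) : Set Plane :=
  {z | ∃ s t : ℝ, 0 < s ∧ s < r ∧ 0 < t ∧ t < r ∧ z = x + (s • u + t • v)}

theorem mem_parallelogram_iff {x u v : Plane} {r : ℝ} (h : wedge u v ≠ 0) {z : Plane} :
    z ∈ parallelogram x u v r ↔
      wedgeEquiv u v h (z - x) ∈ Set.Ioo (0 : ℝ) r ×ˢ Set.Ioo (0 : ℝ) r := by
  constructor
  · rintro ⟨s, t, hs, hs', ht, ht', rfl⟩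
    rw [add_sub_cancel_left, wedgeEquiv_smul_add_smul]
    exact ⟨⟨hs, hs'⟩, ⟨ht, ht'⟩⟩
  · rintro ⟨⟨h1, h2⟩, ⟨h3, h4⟩⟩
    refine ⟨_, _, h1, h2, h3, h4, ?_⟩
    have := (wedgeEquiv u v h).symm_apply_apply (z - x)
    rw [← sub_eq_iff_eq_add']
    exact this.symm

theorem parallelogram_eq_preimage {x u v : Plane} {r : ℝ} (h : wedge u v ≠ 0) :
    parallelogram x u v r =
      (fun z => wedgeEquiv u v h (z - x)) ⁻¹' (Set.Ioo (0 : ℝ) r ×ˢ Set.Ioo (0 : ℝ) r) := by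
  ext z
  exact mem_parallelogram_iff h

theorem isOpen_parallelogram {x u v : Plane} {r : ℝ} (h : wedge u v ≠ 0) :
    IsOpen (parallelogram x u v r) := by
  rw [parallelogram_eq_preimage h]
  exact (isOpen_Ioo.prod isOpen_Ioo).preimage (by fun_prop)

theorem convex_parallelogram (x u v : Plane) (r : ℝ) : Convex ℝ (parallelogram x u v r) := by
  rintro _ ⟨s, t, hs, hs', ht, ht', rfl⟩ _ ⟨s', t', gs, gs', gt, gt', rfl⟩ a b ha hb hab
  refine ⟨a * s + b * s', a * t + b * t', ?_, ?_, ?_, ?_, ?_⟩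
  · exact (convex_Ioi (0 : ℝ)) hs gs ha hb hab
  · exact (convex_Iio r) hs' gs' ha hb hab
  · exact (convex_Ioi (0 : ℝ)) ht gt ha hb hab
  · exact (convex_Iio r) ht' gt' ha hb hab
  · obtain rfl : b = 1 - a := by linarith
    module

theorem volume_parallelogram (x u v : Plane) (r : ℝ) (hr : 0 ≤ r) :
    volume (parallelogram x u v r) = ENNReal.ofReal (r ^ 2 * |wedge u v|) := by
  set b := (EuclideanSpace.basisFun (Fin 2) ℝ).toBasis
  set A : Plane →ₗ[ℝ] Plane := Matrix.toLin b b !![u 0, v 0; u 1, v 1] with hA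
  have hAz : ∀ z : Plane, A z = z 0 • u + z 1 • v := by
    intro z
    have : A z = Matrix.toEuclideanLin !![u 0, v 0; u 1, v 1] z := by
      rw [Matrix.toEuclideanLin_eq_toLin_orthonormal]
    rw [this]
    ext i
    fin_cases i <;>
      simp [Matrix.toLpLin_apply, dotProduct, Fin.sum_univ_two, mul_comm]
  set Q : Set Plane := {z | ∀ i, z i ∈ Set.Ioo (0 : ℝ) r}
  have himg : parallelogram x u v r = (fun z => x + z) '' (A '' Q) := by
    ext z
    constructor
    · rintro ⟨s, t, hs, hs', ht, ht', rfl⟩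
      refine ⟨_, ⟨!₂[s, t], ?_, rfl⟩, ?_⟩
      · intro i
        fin_cases i
        · exact ⟨hs, hs'⟩
        · exact ⟨ht, ht'⟩
      · simp [hAz]
    · rintro ⟨_, ⟨p, hp, rfl⟩, rfl⟩
      exact ⟨p 0, p 1, (hp 0).1, (hp 0).2, (hp 1).1, (hp 1).2, by simp [hAz]⟩
  have hQ : volume Q = ENNReal.ofReal r ^ 2 := by
    have : Q = (WithLp.ofLp : Plane → (Fin 2 → ℝ)) ⁻¹'
        (Set.univ.pi fun _ => Set.Ioo (0 : ℝ) r) := by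
      ext z
      simp [Q]
    rw [this, (PiLp.volume_preserving_ofLp (Fin 2)).measure_preimage
      (MeasurableSet.univ_pi fun _ => measurableSet_Ioo).nullMeasurableSet, volume_pi_pi]
    simp
  rw [himg, Set.image_add_left, measure_preimage_add, Measure.addHaar_image_linearMap, hQ, hA,
    LinearMap.det_toLin, Matrix.det_fin_two_of, ← ENNReal.ofReal_pow hr,
    ← ENNReal.ofReal_mul (abs_nonneg _), mul_comm]
  congr 3
  simp only [wedge]; ring

theorem volume_line_eq_zero (a b : Plane) : volume (affineSpan ℝ {a, b} : Set Plane) = 0 := by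
  apply Measure.addHaar_affineSubspace
  intro h
  have h1 : Module.finrank ℝ (vectorSpan ℝ ({a, b} : Set Plane)) = 2 := by
    rw [← direction_affineSpan, h, AffineSubspace.direction_top, finrank_top,
      finrank_euclideanSpace_fin]
  have h2 := collinear_iff_finrank_le_one.1 (collinear_pair ℝ a b)
  omega

theorem volume_segment_eq_zero (a b : Plane) : volume (segment ℝ a b) = 0 :=
  measure_mono_null
    (convexHull_pair (𝕜 := ℝ) a b ▸ convexHull_subset_affineSpan _) (volume_line_eq_zero a b)

theorem IsPreconnected.subset_of_disjoint_frontier {X : Type*} [TopologicalSpace X] {s u : Set X}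
    (hs : IsPreconnected s) (hu : IsOpen u) (hne : (s ∩ u).Nonempty)
    (hd : Disjoint s (frontier u)) : s ⊆ u := by
  refine hs.subset_of_closure_inter_subset hu hne ?_
  rintro z ⟨hz, hzs⟩
  by_contra hzu
  exact Set.disjoint_left.1 hd hzs ⟨hz, fun h => hzu (interior_subset h)⟩

/-- Base times height is at most twice the area of a triangle. -/
theorem dist_mul_distToEdgeLine_le (x : Plane) (e : Plane × Plane) :
    dist e.1 e.2 * distToEdgeLine x e ≤ |wedge (e.1 - x) (e.2 - x)| := by
  obtain ⟨a, b⟩ := e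
  simp only [distToEdgeLine]
  by_cases hab : a = b
  · subst hab
    simp
  have hpos : 0 < dist a b := dist_pos.2 hab
  set w : Plane := b - a with hw
  set g : Plane := x - a with hg
  have hN : dist a b ^ 2 = w 0 ^ 2 + w 1 ^ 2 := by
    rw [dist_comm, dist_eq_norm, EuclideanSpace.norm_sq_eq]
    simp [Fin.sum_univ_two, hw]
  set τ : ℝ := (g 0 * w 0 + g 1 * w 1) / dist a b ^ 2 with hτ
  have hp : AffineMap.lineMap a b τ ∈ (affineSpan ℝ {a, b} : Set Plane) :=
    AffineMap.lineMap_mem_affineSpan_pair τ a b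
  -- the foot of the perpendicular realises the distance
  have hfoot : (dist a b * dist x (AffineMap.lineMap a b τ)) ^ 2 = wedge (a - x) (b - x) ^ 2 := by
    have e1 : dist x (AffineMap.lineMap a b τ) ^ 2
        = (g 0 - τ * w 0) ^ 2 + (g 1 - τ * w 1) ^ 2 := by
      rw [dist_eq_norm, EuclideanSpace.norm_sq_eq]
      simp only [AffineMap.lineMap_apply, vsub_eq_sub, vadd_eq_add, Fin.sum_univ_two,
        PiLp.sub_apply, PiLp.add_apply, PiLp.smul_apply, smul_eq_mul, Real.norm_eq_abs, sq_abs,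
        hg, hw]
      ring
    have e2 : wedge (a - x) (b - x) = w 0 * g 1 - w 1 * g 0 := by
      simp only [wedge, hg, hw, PiLp.sub_apply]; ring
    have e3 : τ * (w 0 ^ 2 + w 1 ^ 2) = g 0 * w 0 + g 1 * w 1 := by
      rw [hτ, hN]
      have : w 0 ^ 2 + w 1 ^ 2 ≠ 0 := by rw [← hN]; positivity
      field_simp
    rw [mul_pow, e1, e2, hN]
    linear_combination (τ * (w 0 ^ 2 + w 1 ^ 2) - (g 0 * w 0 + g 1 * w 1)) * e3
  calc dist a b * Metric.infDist x (affineSpan ℝ {a, b} : Set Plane)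
      ≤ dist a b * dist x (AffineMap.lineMap a b τ) := by
        gcongr
        exact Metric.infDist_le_dist_of_mem hp
    _ = |wedge (a - x) (b - x)| := by
        rw [← abs_of_nonneg (by positivity : 0 ≤ dist a b * dist x (AffineMap.lineMap a b τ))]
        exact (sq_eq_sq_iff_abs_eq_abs _ _).1 hfoot

/-! ### Local structure of a mesh at a point of an interior edge -/

namespace PolygonalMesh

variable {Ω : Set Plane} {T Eint Eext : Type*}

/-- The set of end points of the interior edges. -/
def vertices (M : PolygonalMesh Ω T Eint Eext) : Set Plane :=
  ⋃ σ, {(M.intEdge σ).1, (M.intEdge σ).2}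

theorem finite_vertices [Finite Eint] (M : PolygonalMesh Ω T Eint Eext) : M.vertices.Finite :=
  Set.finite_iUnion fun _ => Set.toFinite _

theorem isClosed_edgeSet (e : Plane × Plane) : IsClosed (edgeSet e) := by
  rw [edgeSet, ← convexHull_pair]
  exact ((Set.toFinite _).isCompact_convexHull ℝ).isClosed

theorem exists_mem_closure_cell [Finite T] (M : PolygonalMesh Ω T Eint Eext) {z : Plane}
    (hz : z ∈ Ω) : ∃ K, z ∈ closure (M.cell K) := by
  have h : z ∈ closure (⋃ K, M.cell K) := M.closure_iUnion_cell ▸ subset_closure hz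
  rwa [closure_iUnion_of_finite, Set.mem_iUnion] at h

theorem mem_edge_of_mem_frontier (M : PolygonalMesh Ω T Eint Eext) (hΩ : IsOpen Ω) {z : Plane}
    (hz : z ∈ Ω) {K : T} (hK : z ∈ frontier (M.cell K)) :
    ∃ σ, (M.left σ = K ∨ M.right σ = K) ∧ z ∈ edgeSet (M.intEdge σ) := by
  rw [M.frontier_cell] at hK
  rcases hK with h | h
  · simpa using h
  · simp only [Set.mem_iUnion] at h
    obtain ⟨σ, -, h⟩ := h
    have := M.extEdge_subset σ h
    rw [hΩ.frontier_eq] at this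
    exact absurd hz this.2

theorem edgeSet_subset_frontier (M : PolygonalMesh Ω T Eint Eext) {σ : Eint} {K : T}
    (h : M.left σ = K ∨ M.right σ = K) : edgeSet (M.intEdge σ) ⊆ frontier (M.cell K) := by
  rw [M.frontier_cell]
  refine Set.subset_union_of_subset_left ?_ _
  exact Set.subset_biUnion_of_mem (u := fun σ => edgeSet (M.intEdge σ)) h

theorem mem_edgeInterior (M : PolygonalMesh Ω T Eint Eext) {σ : Eint} {z : Plane}
    (hv : z ∉ M.vertices) (hz : z ∈ edgeSet (M.intEdge σ)) : z ∈ edgeInterior (M.intEdge σ) := by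
  have h1 : z ∉ ({(M.intEdge σ).1, (M.intEdge σ).2} : Set Plane) := fun h =>
    hv (Set.mem_iUnion.2 ⟨σ, h⟩)
  simp only [Set.mem_insert_iff, Set.mem_singleton_iff, not_or] at h1
  exact mem_openSegment_of_ne_left_right (Ne.symm h1.1) (Ne.symm h1.2) hz

theorem eq_of_mem_of_mem_closure (M : PolygonalMesh Ω T Eint Eext) {z : Plane} {K L : T}
    (hK : z ∈ M.cell K) (hL : z ∈ closure (M.cell L)) : K = L := by
  by_contra h
  obtain ⟨y, hyK, hyL⟩ := mem_closure_iff.1 hL _ (M.isOpen_cell K) hK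
  exact Set.disjoint_left.1 (M.disjoint_cell K L h) hyK hyL

theorem not_mem_cell_of_mem_edge (M : PolygonalMesh Ω T Eint Eext) {σ : Eint} {z : Plane}
    (hz : z ∈ edgeSet (M.intEdge σ)) (K : T) : z ∉ M.cell K := by
  intro hK
  have h1 := M.edgeSet_subset_frontier (Or.inl rfl) hz
  have h2 := M.edgeSet_subset_frontier (Or.inr rfl) hz
  exact M.left_ne_right σ ((M.eq_of_mem_of_mem_closure hK h1.1).symm.trans
    (M.eq_of_mem_of_mem_closure hK h2.1))

/-- The side of the line through `e.1` and `e.2` on which `p` lies, as a signed quantity. -/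
def side (e : Plane × Plane) (p : Plane) : ℝ := wedge (e.2 - e.1) (p - e.1)

theorem side_combo (e : Plane × Plane) (p q : Plane) {a b : ℝ} (hab : a + b = 1) :
    side e (a • p + b • q) = a * side e p + b * side e q := by
  obtain rfl : b = 1 - a := by linarith
  simp only [side, wedge, PiLp.add_apply, PiLp.sub_apply, PiLp.smul_apply, smul_eq_mul]
  ring

theorem side_eq_zero_of_mem_edgeSet {e : Plane × Plane} {p : Plane} (h : p ∈ edgeSet e) :
    side e p = 0 := by
  obtain ⟨a, b, -, -, hab, rfl⟩ := h
  rw [side_combo _ _ _ hab]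
  simp only [side, wedge, PiLp.sub_apply]
  ring

/-- The open half disc of centre `z` and radius `ρ`, on the side of `e` given by the sign of `s`. -/
def halfDisc (e : Plane × Plane) (z : Plane) (ρ s : ℝ) : Set Plane :=
  {p | p ∈ Metric.ball z ρ ∧ 0 < s * side e p}

theorem convex_halfDisc (e : Plane × Plane) (z : Plane) (ρ s : ℝ) :
    Convex ℝ (halfDisc e z ρ s) := by
  rintro p ⟨hp, hp'⟩ q ⟨hq, hq'⟩ a b ha hb hab
  refine ⟨convex_ball z ρ hp hq ha hb hab, ?_⟩
  rw [side_combo _ _ _ hab]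
  have := (convex_Ioi (0 : ℝ)) hp' hq' ha hb hab
  simp only [smul_eq_mul, Set.mem_Ioi] at this
  linarith

/-- Every ball about a point of the line contains points strictly on either side. -/
theorem nonempty_halfDisc {e : Plane × Plane} (he : e.1 ≠ e.2) {z : Plane} (hz : side e z = 0)
    {ρ : ℝ} (hρ : 0 < ρ) {s : ℝ} (hs : s ≠ 0) : (halfDisc e z ρ s).Nonempty := by
  set n : Plane := !₂[-(e.2 - e.1) 1, (e.2 - e.1) 0] with hn
  have hside : ∀ t : ℝ, side e (z + t • n) = t * ‖e.2 - e.1‖ ^ 2 := by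
    intro t
    have : side e (z + t • n) = side e z + t * ((e.2 - e.1) 0 ^ 2 + (e.2 - e.1) 1 ^ 2) := by
      simp [side, wedge, hn]
      ring
    rw [this, hz, EuclideanSpace.norm_sq_eq]
    simp [Fin.sum_univ_two]
  have hc : Filter.Tendsto (fun t : ℝ => z + (t * s) • n) (nhdsWithin 0 (Set.Ioi 0)) (nhds z) := by
    have : Continuous fun t : ℝ => z + (t * s) • n := by fun_prop
    simpa using (this.tendsto 0).mono_left nhdsWithin_le_nhds
  obtain ⟨t, ht, ht0⟩ := ((hc.eventually (Metric.ball_mem_nhds z hρ)).and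
    self_mem_nhdsWithin).exists
  refine ⟨_, ht, ?_⟩
  rw [hside]
  have h1 : 0 < ‖e.2 - e.1‖ := norm_pos_iff.2 (sub_ne_zero.2 he.symm)
  have h2 : 0 < s ^ 2 := by positivity
  have h3 : (0 : ℝ) < t := ht0
  have : s * (t * s * ‖e.2 - e.1‖ ^ 2) = s ^ 2 * t * ‖e.2 - e.1‖ ^ 2 := by ring
  rw [this]
  positivity

/-- A nonempty open set is not contained in a line. -/
theorem exists_side_ne_zero {e : Plane × Plane} (he : e.1 ≠ e.2) {U : Set Plane} (hU : IsOpen U)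
    (hne : U.Nonempty) : ∃ p ∈ U, side e p ≠ 0 := by
  obtain ⟨z, hz⟩ := hne
  by_cases h : side e z = 0
  · obtain ⟨ρ, hρ, hb⟩ := Metric.isOpen_iff.1 hU z hz
    obtain ⟨p, hp, hp'⟩ := nonempty_halfDisc he h hρ one_ne_zero
    exact ⟨p, hb hp, fun h0 => by simp [h0] at hp'⟩
  · exact ⟨z, hz, h⟩

/-- Near a point `z` of an interior edge that is no vertex, the two sides of the edge are each
contained in a control volume: every control volume touching `z` contains one of the half discs. -/
theorem exists_halfDisc_subset [Finite Eint] (M : PolygonalMesh Ω T Eint Eext) (hΩ : IsOpen Ω)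
    {σ : Eint} {z : Plane} (hv : z ∉ M.vertices) (hz : z ∈ edgeSet (M.intEdge σ)) :
    ∃ ρ > 0, ∀ K, z ∈ closure (M.cell K) →
      halfDisc (M.intEdge σ) z ρ 1 ⊆ M.cell K ∨ halfDisc (M.intEdge σ) z ρ (-1) ⊆ M.cell K := by
  have hzi := M.mem_edgeInterior hv hz
  have hzΩ := M.intEdge_subset σ hzi
  set F : Set Plane := ⋃ τ ∈ {τ | τ ≠ σ}, edgeSet (M.intEdge τ) with hF
  have hFc : IsClosed F := (Set.toFinite _).isClosed_biUnion fun τ _ => isClosed_edgeSet _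
  have hzF : z ∉ F := by
    simp only [hF, Set.mem_iUnion, not_exists]
    intro τ hτ hzτ
    exact Set.disjoint_left.1 (M.disjoint_intEdge τ σ hτ) (M.mem_edgeInterior hv hzτ) hzi
  obtain ⟨ρ, hρ, hball⟩ := Metric.isOpen_iff.1 (hΩ.inter hFc.isOpen_compl) z ⟨hzΩ, hzF⟩
  have hdisj : ∀ s : ℝ, ∀ K, Disjoint (halfDisc (M.intEdge σ) z ρ s) (frontier (M.cell K)) := by
    intro s K
    rw [Set.disjoint_left]
    rintro p ⟨hp, hp'⟩ hpK
    obtain ⟨hpΩ, hpF⟩ := hball hp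
    obtain ⟨τ, -, hpτ⟩ := M.mem_edge_of_mem_frontier hΩ hpΩ hpK
    by_cases hτ : τ = σ
    · subst hτ
      simp [side_eq_zero_of_mem_edgeSet hpτ] at hp'
    · exact hpF (Set.mem_biUnion (show τ ∈ {τ | τ ≠ σ} from hτ) hpτ)
  refine ⟨ρ, hρ, fun K hK => ?_⟩
  have hne : (Metric.ball z ρ ∩ M.cell K).Nonempty :=
    mem_closure_iff.1 hK _ Metric.isOpen_ball (Metric.mem_ball_self hρ)
  obtain ⟨p, ⟨hpb, hpK⟩, hp⟩ := exists_side_ne_zero (M.intEdge_nondegenerate σ)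
    (Metric.isOpen_ball.inter (M.isOpen_cell K)) hne
  rcases hp.lt_or_gt with h | h
  · right
    exact (convex_halfDisc _ _ _ _).isPreconnected.subset_of_disjoint_frontier (M.isOpen_cell K)
      ⟨p, ⟨hpb, by linarith⟩, hpK⟩ (hdisj _ K)
  · left
    exact (convex_halfDisc _ _ _ _).isPreconnected.subset_of_disjoint_frontier (M.isOpen_cell K)
      ⟨p, ⟨hpb, by linarith⟩, hpK⟩ (hdisj _ K)

theorem eq_of_subset_of_subset (M : PolygonalMesh Ω T Eint Eext) {H : Set Plane} (hH : H.Nonempty)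
    {K L : T} (hK : H ⊆ M.cell K) (hL : H ⊆ M.cell L) : K = L := by
  obtain ⟨p, hp⟩ := hH
  exact M.eq_of_mem_of_mem_closure (hK hp) (subset_closure (hL hp))

/-- Two distinct control volumes touching a point of `Ω` that is no vertex are the two neighbours
of an interior edge through that point. -/
theorem exists_edge_of_mem_closure [Finite Eint] (M : PolygonalMesh Ω T Eint Eext) (hΩ : IsOpen Ω)
    {z : Plane} (hz : z ∈ Ω) (hv : z ∉ M.vertices) {K L : T} (hK : z ∈ closure (M.cell K))
    (hL : z ∈ closure (M.cell L)) (hKL : K ≠ L) :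
    ∃ σ, z ∈ edgeSet (M.intEdge σ) ∧
      ((M.left σ = K ∧ M.right σ = L) ∨ (M.left σ = L ∧ M.right σ = K)) := by
  have hfr : z ∈ frontier (M.cell K) := by
    rw [(M.isOpen_cell K).frontier_eq]
    exact ⟨hK, fun h => hKL (M.eq_of_mem_of_mem_closure h hL)⟩
  obtain ⟨σ, hσ, hzσ⟩ := M.mem_edge_of_mem_frontier hΩ hz hfr
  refine ⟨σ, hzσ, ?_⟩
  obtain ⟨ρ, hρ, h⟩ := M.exists_halfDisc_subset hΩ hv hzσ
  have hside := side_eq_zero_of_mem_edgeSet hzσ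
  have hn1 := nonempty_halfDisc (M.intEdge_nondegenerate σ) hside hρ (one_ne_zero : (1 : ℝ) ≠ 0)
  have hn2 := nonempty_halfDisc (M.intEdge_nondegenerate σ) hside hρ
    (neg_ne_zero.2 one_ne_zero : (-1 : ℝ) ≠ 0)
  have hl := h _ (M.edgeSet_subset_frontier (Or.inl rfl) hzσ).1
  have hr := h _ (M.edgeSet_subset_frontier (Or.inr rfl) hzσ).1
  have hlr := M.left_ne_right σ
  have e1 := fun A B hA hB => M.eq_of_subset_of_subset hn1 (K := A) (L := B) hA hB
  have e2 := fun A B hA hB => M.eq_of_subset_of_subset hn2 (K := A) (L := B) hA hB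
  rcases hσ with rfl | rfl
  · left
    refine ⟨rfl, ?_⟩
    rcases hl with hl | hl <;> rcases hr with hr | hr <;> rcases h _ hL with hL | hL
    all_goals first
      | exact e1 _ _ hr hL
      | exact e2 _ _ hr hL
      | exact absurd (e1 _ _ hl hr) hlr
      | exact absurd (e2 _ _ hl hr) hlr
      | exact absurd (e1 _ _ hl hL) hKL
      | exact absurd (e2 _ _ hl hL) hKL
  · right
    refine ⟨?_, rfl⟩
    rcases hl with hl | hl <;> rcases hr with hr | hr <;> rcases h _ hL with hL | hL
    all_goals first
      | exact e1 _ _ hl hL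
      | exact e2 _ _ hl hL
      | exact absurd (e1 _ _ hl hr) hlr
      | exact absurd (e2 _ _ hl hr) hlr
      | exact absurd (e1 _ _ hr hL) hKL
      | exact absurd (e2 _ _ hr hL) hKL

/-- Almost every point of `Ω` belongs to a control volume. -/
theorem volume_diff_iUnion_cell [Finite T] [Finite Eint] (M : PolygonalMesh Ω T Eint Eext)
    (hΩ : IsOpen Ω) : volume (Ω \ ⋃ K, M.cell K) = 0 := by
  refine measure_mono_null (t := ⋃ σ, edgeSet (M.intEdge σ)) ?_
    (measure_iUnion_null fun σ => volume_segment_eq_zero _ _)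
  rintro z ⟨hz, hzK⟩
  obtain ⟨K, hK⟩ := M.exists_mem_closure_cell hz
  obtain ⟨σ, -, h⟩ := M.mem_edge_of_mem_frontier hΩ hz
    (K := K) (by rw [(M.isOpen_cell K).frontier_eq]
                 exact ⟨hK, fun h => hzK (Set.mem_iUnion.2 ⟨K, h⟩)⟩)
  exact Set.mem_iUnion.2 ⟨σ, h⟩

end PolygonalMesh

/-! ### Discrete functions along lines -/

/-- Induction along the unit interval. -/
theorem unitInterval_real_induction {P : ℝ → Prop} (h0 : P 0)
    (hl : ∀ s, 0 < s → s ≤ 1 → (∀ t, 0 ≤ t → t < s → P t) → P s)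
    (hr : ∀ s, 0 ≤ s → s < 1 → P s → ∀ᶠ t in nhdsWithin s (Set.Ioi s), P t) : P 1 := by
  set S : Set ℝ := {s | 0 ≤ s ∧ s ≤ 1 ∧ ∀ t, 0 ≤ t → t ≤ s → P t} with hS
  have h0S : (0 : ℝ) ∈ S := ⟨le_rfl, zero_le_one, fun t ht ht' => by
    rwa [le_antisymm ht' ht]⟩
  have hb : BddAbove S := ⟨1, fun s hs => hs.2.1⟩
  set c := sSup S with hc
  have hc0 : 0 ≤ c := le_csSup hb h0S
  have hc1 : c ≤ 1 := csSup_le ⟨0, h0S⟩ fun s hs => hs.2.1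
  have hlt : ∀ t, 0 ≤ t → t < c → P t := by
    intro t ht htc
    obtain ⟨s, hs, hts⟩ := exists_lt_of_lt_csSup ⟨0, h0S⟩ htc
    exact hs.2.2 t ht hts.le
  have hPc : P c := by
    rcases hc0.eq_or_lt with h | h
    · rwa [← h]
    · exact hl c h hc1 hlt
  rcases hc1.eq_or_lt with h | h
  · rwa [← h]
  exfalso
  obtain ⟨d, hd, hd'⟩ := mem_nhdsGT_iff_exists_Ioo_subset.1 (hr c hc0 h hPc)
  have hcd : c < d := hd
  set e := min 1 ((c + d) / 2) with he
  have hce : c < e := lt_min h (by linarith)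
  have hed : e < d := (min_le_right _ _).trans_lt (by linarith)
  have heS : e ∈ S := by
    refine ⟨hc0.trans hce.le, min_le_left _ _, fun t ht hte => ?_⟩
    rcases lt_trichotomy t c with h1 | h1 | h1
    · exact hlt t ht h1
    · rwa [h1]
    · exact hd' ⟨h1, hte.trans_lt hed⟩
  exact absurd (le_csSup hb heS) (not_le.2 hce)

namespace PolygonalMesh

variable {Ω : Set Plane} {T Eint Eext : Type*}

/-- The jump `|f_K - f_L|` of a discrete function across the interior edge `K|L`. -/
def jump (M : PolygonalMesh Ω T Eint Eext) (f : T → ℝ) (σ : Eint) : ℝ :=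
  |f (M.left σ) - f (M.right σ)|

theorem jump_nonneg (M : PolygonalMesh Ω T Eint Eext) (f : T → ℝ) (σ : Eint) : 0 ≤ M.jump f σ :=
  abs_nonneg _

/-- The sum of the jumps of a discrete function across the interior edges that meet the line
`l = t`. -/
noncomputable def lineVariation [Fintype Eint] (M : PolygonalMesh Ω T Eint Eext) (f : T → ℝ)
    (l : Plane →ₗ[ℝ] ℝ) (t : ℝ) : ℝ :=
  ∑ σ, (l '' edgeSet (M.intEdge σ)).indicator (fun _ => M.jump f σ) t

/-- A linear form that takes one value twice on a segment takes it at the end points. -/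
theorem eq_of_mem_segment {l : Plane →ₗ[ℝ] ℝ} {t : ℝ} {e : Plane × Plane} (h : l e.1 ≠ t)
    {p q : Plane} (hp : p ∈ edgeSet e) (hq : q ∈ edgeSet e) (hlp : l p = t) (hlq : l q = t) :
    p = q := by
  obtain ⟨a, b, -, -, hab, rfl⟩ := hp
  obtain ⟨c, d, -, -, hcd, rfl⟩ := hq
  obtain rfl : a = 1 - b := by linarith
  obtain rfl : c = 1 - d := by linarith
  simp only [map_add, map_smul, smul_eq_mul] at hlp hlq
  have h1 : (b - d) * (l e.2 - l e.1) = 0 := by linear_combination hlp - hlq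
  rcases mul_eq_zero.1 h1 with h2 | h2
  · rw [sub_eq_zero.1 h2]
  · exact absurd (by linear_combination hlp - b * h2) h

/-- On a segment inside `Ω` that lies on a line without vertices, the total change of a discrete
function is at most the sum of its jumps across the edges that meet this line. -/
theorem abs_sub_le_lineVariation [Finite T] [Fintype Eint] (M : PolygonalMesh Ω T Eint Eext)
    (hΩ : IsOpen Ω) (f : T → ℝ) {l : Plane →ₗ[ℝ] ℝ} {t : ℝ} (hv : ∀ p ∈ M.vertices, l p ≠ t)
    {z w : Plane} (hzw : segment ℝ z w ⊆ Ω) (hz : l z = t) (hw : l w = t) {K L : T}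
    (hK : z ∈ closure (M.cell K)) (hL : w ∈ closure (M.cell L)) :
    |f K - f L| ≤ M.lineVariation f l t := by
  classical
  set γ : ℝ → Plane := fun s => z + s • (w - z) with hγ
  have hγc : Continuous γ := by fun_prop
  have hγΩ : ∀ s, 0 ≤ s → s ≤ 1 → γ s ∈ Ω := fun s h0 h1 => by
    apply hzw
    rw [segment_eq_image']
    exact ⟨s, ⟨h0, h1⟩, rfl⟩
  have hγl : ∀ s, l (γ s) = t := fun s => by
    simp [hγ, hz, hw]
  have hγv : ∀ s, γ s ∉ M.vertices := fun s h => hv _ h (hγl s)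
  set A : Eint → ℝ → Prop := fun σ s => ∃ s', 0 ≤ s' ∧ s' ≤ s ∧ γ s' ∈ edgeSet (M.intEdge σ) with hA
  have hAmono : ∀ σ s s', s ≤ s' → A σ s → A σ s' := fun σ s s' h ⟨r, h0, h1, h2⟩ =>
    ⟨r, h0, h1.trans h, h2⟩
  set φ : ℝ → ℝ := fun s => ∑ σ, if A σ s then M.jump f σ else 0 with hφ
  have hφmono : ∀ s s', s ≤ s' → φ s ≤ φ s' := by
    intro s s' h
    refine Finset.sum_le_sum fun σ _ => ?_
    by_cases h1 : A σ s
    · rw [if_pos h1, if_pos (hAmono σ s s' h h1)]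
    · rw [if_neg h1]
      split_ifs
      exacts [M.jump_nonneg f σ, le_rfl]
  have hjump : ∀ s s' σ, s ≤ s' → ¬ A σ s → A σ s' → φ s + M.jump f σ ≤ φ s' := by
    intro s s' σ h h1 h2
    have hsum : ∀ r, φ r = (if A σ r then M.jump f σ else 0)
        + ∑ τ ∈ Finset.univ.erase σ, if A τ r then M.jump f τ else 0 := fun r =>
      (Finset.add_sum_erase _ _ (Finset.mem_univ σ)).symm
    rw [hsum s, hsum s', if_neg h1, if_pos h2, zero_add, add_comm]
    gcongr with τ _
    by_cases h3 : A τ s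
    · rw [if_pos h3, if_pos (hAmono τ s s' h h3)]
    · rw [if_neg h3]
      split_ifs
      exacts [M.jump_nonneg f τ, le_rfl]
  have hφV : ∀ s, φ s ≤ M.lineVariation f l t := by
    intro s
    refine Finset.sum_le_sum fun σ _ => ?_
    split_ifs with h
    · obtain ⟨s', -, -, h'⟩ := h
      have ht : t ∈ l '' edgeSet (M.intEdge σ) := ⟨_, h', hγl s'⟩
      rw [Set.indicator_of_mem ht]
    · exact Set.indicator_nonneg (fun _ _ => M.jump_nonneg f σ) t
  -- control volumes that touch a nearby point touch the given point
  have hnear : ∀ s, ∀ᶠ r in nhds s, ∀ J, γ r ∈ closure (M.cell J) → γ s ∈ closure (M.cell J) := by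
    intro s
    rw [Filter.eventually_all]
    intro J
    by_cases h : γ s ∈ closure (M.cell J)
    · exact Filter.Eventually.of_forall fun _ _ => h
    · filter_upwards [hγc.continuousAt.preimage_mem_nhds (isClosed_closure.isOpen_compl.mem_nhds h)]
        with r hr hr'
      exact absurd hr' hr
  have hstep : ∀ s, 0 ≤ s → s ≤ 1 → ∀ I J, γ s ∈ closure (M.cell I) → γ s ∈ closure (M.cell J) →
      I ≠ J → ∃ σ, γ s ∈ edgeSet (M.intEdge σ) ∧ |f I - f J| = M.jump f σ := by
    intro s h0 h1 I J hI hJ hIJ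
    obtain ⟨σ, hσ, ⟨rfl, rfl⟩ | ⟨rfl, rfl⟩⟩ :=
      M.exists_edge_of_mem_closure hΩ (hγΩ s h0 h1) (hγv s) hI hJ hIJ
    · exact ⟨σ, hσ, rfl⟩
    · exact ⟨σ, hσ, abs_sub_comm _ _⟩
  suffices h : ∀ J, γ 1 ∈ closure (M.cell J) → |f K - f J| ≤ φ 1 by
    exact (h L (by simpa [hγ] using hL)).trans (hφV 1)
  refine unitInterval_real_induction (P := fun s => ∀ J, γ s ∈ closure (M.cell J) →
    |f K - f J| ≤ φ s) ?_ ?_ ?_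
  · intro J hJ
    have hK0 : γ 0 ∈ closure (M.cell K) := by simpa [hγ] using hK
    have hφ0 : ∀ s, 0 ≤ φ s := fun s => Finset.sum_nonneg fun σ _ => by
      split_ifs
      exacts [M.jump_nonneg f σ, le_rfl]
    by_cases hKJ : K = J
    · subst hKJ
      simpa using hφ0 0
    · obtain ⟨σ, hσ, he⟩ := hstep 0 le_rfl zero_le_one K J hK0 hJ hKJ
      rw [he]
      refine (le_of_eq ?_).trans (Finset.single_le_sum
        (f := fun σ => if A σ 0 then M.jump f σ else 0)
        (fun τ _ => ?_) (Finset.mem_univ σ))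
      · exact (if_pos ⟨0, le_rfl, le_rfl, hσ⟩).symm
      · split_ifs
        exacts [M.jump_nonneg f τ, le_rfl]
  · intro s hs0 hs1 ih J hJ
    obtain ⟨r, hr, hrs, hr0⟩ := (((hnear s).filter_mono nhdsWithin_le_nhds).and
      ((eventually_mem_nhdsWithin (a := s) (s := Set.Iio s)).and
        ((lt_mem_nhds hs0).filter_mono nhdsWithin_le_nhds))).exists
    have hrs' : r < s := hrs
    obtain ⟨I, hI⟩ := M.exists_mem_closure_cell (hγΩ r hr0.le (hrs'.le.trans hs1))
    have h1 := ih r hr0.le hrs' I hI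
    by_cases hIJ : I = J
    · subst hIJ
      exact h1.trans (hφmono _ _ hrs'.le)
    obtain ⟨σ, hσ, he⟩ := hstep s hs0.le hs1 I J (hr I hI) hJ hIJ
    by_cases hAσ : A σ r
    · -- the edge meets the line in one point only, which was reached before
      obtain ⟨r', h0, h2, h3⟩ := hAσ
      have heq : γ r' = γ s := eq_of_mem_segment
        (hv _ (Set.mem_iUnion.2 ⟨σ, Set.mem_insert _ _⟩)) h3 hσ (hγl r') (hγl s)
      exact (ih r' h0 (h2.trans_lt hrs') J (heq ▸ hJ)).trans (hφmono _ _ (h2.trans hrs'.le))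
    · calc |f K - f J| ≤ |f K - f I| + |f I - f J| := abs_sub_le _ _ _
        _ ≤ φ r + M.jump f σ := by rw [he]; gcongr
        _ ≤ φ s := hjump r s σ hrs'.le hAσ ⟨s, hs0.le, le_rfl, hσ⟩
  · intro s _ _ ih
    filter_upwards [(hnear s).filter_mono nhdsWithin_le_nhds, self_mem_nhdsWithin]
      with r hr hsr J hJ
    exact (ih J (hr J hJ)).trans (hφmono _ _ (le_of_lt hsr))

/-- The total variation of a discrete function: the sum of its jumps across the interior edges,
weighted by the lengths of the edges. -/
noncomputable def variation [Fintype Eint] (M : PolygonalMesh Ω T Eint Eext) (f : T → ℝ) : ℝ :=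
  ∑ σ, edgeLength (M.intEdge σ) * M.jump f σ

theorem edgeLength_nonneg (e : Plane × Plane) : 0 ≤ edgeLength e := ENNReal.toReal_nonneg

theorem variation_nonneg [Fintype Eint] (M : PolygonalMesh Ω T Eint Eext) (f : T → ℝ) :
    0 ≤ M.variation f :=
  Finset.sum_nonneg fun σ _ => mul_nonneg (edgeLength_nonneg _) (M.jump_nonneg f σ)

theorem lineVariation_nonneg [Fintype Eint] (M : PolygonalMesh Ω T Eint Eext) (f : T → ℝ)
    (l : Plane →ₗ[ℝ] ℝ) (t : ℝ) : 0 ≤ M.lineVariation f l t :=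
  Finset.sum_nonneg fun σ _ => Set.indicator_nonneg (fun _ _ => M.jump_nonneg f σ) t

theorem image_edgeSet (l : Plane →ₗ[ℝ] ℝ) (e : Plane × Plane) :
    l '' edgeSet e = Set.uIcc (l e.1) (l e.2) := by
  rw [edgeSet, ← segment_eq_uIcc]
  exact image_segment ℝ l.toAffineMap e.1 e.2

theorem measurable_lineVariation [Fintype Eint] (M : PolygonalMesh Ω T Eint Eext) (f : T → ℝ)
    (l : Plane →ₗ[ℝ] ℝ) : Measurable (M.lineVariation f l) := by
  unfold lineVariation
  refine Finset.measurable_sum _ fun σ _ => Measurable.indicator measurable_const ?_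
  rw [image_edgeSet]
  exact measurableSet_uIcc

/-- The part of the coarea formula that is needed: slicing by a Lipschitz linear form. -/
theorem lintegral_lineVariation_le [Fintype Eint] (M : PolygonalMesh Ω T Eint Eext) (f : T → ℝ)
    (l : Plane →ₗ[ℝ] ℝ) {C : ℝ} (hC0 : 0 ≤ C) (hC : ∀ z, |l z| ≤ C * ‖z‖) :
    ∫⁻ t, ENNReal.ofReal (M.lineVariation f l t) ≤ ENNReal.ofReal (C * M.variation f) := by
  have h1 : ∀ t, ENNReal.ofReal (M.lineVariation f l t)
      = ∑ σ, (l '' edgeSet (M.intEdge σ)).indicator (fun _ => ENNReal.ofReal (M.jump f σ)) t := by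
    intro t
    rw [lineVariation, ENNReal.ofReal_sum_of_nonneg fun σ _ =>
      Set.indicator_nonneg (fun _ _ => M.jump_nonneg f σ) t]
    refine Finset.sum_congr rfl fun σ _ => ?_
    by_cases h : t ∈ l '' edgeSet (M.intEdge σ)
    · rw [Set.indicator_of_mem h, Set.indicator_of_mem h]
    · rw [Set.indicator_of_notMem h, Set.indicator_of_notMem h, ENNReal.ofReal_zero]
  have hm : ∀ σ, MeasurableSet (l '' edgeSet (M.intEdge σ)) := fun σ => by
    rw [image_edgeSet]
    exact measurableSet_uIcc
  simp_rw [h1]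
  rw [lintegral_finsetSum _ fun σ _ => measurable_const.indicator (hm σ), variation, Finset.mul_sum]
  have hterm : ∀ σ, ∫⁻ t, (l '' edgeSet (M.intEdge σ)).indicator
      (fun _ => ENNReal.ofReal (M.jump f σ)) t
      ≤ ENNReal.ofReal (C * (edgeLength (M.intEdge σ) * M.jump f σ)) := by
    intro σ
    rw [lintegral_indicator_const (hm σ), image_edgeSet, Real.volume_interval,
      ← ENNReal.ofReal_mul (M.jump_nonneg f σ)]
    apply ENNReal.ofReal_le_ofReal
    rw [edgeLength_eq_dist, dist_comm, dist_eq_norm, ← map_sub, mul_comm, ← mul_assoc]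
    exact mul_le_mul_of_nonneg_right (hC _) (M.jump_nonneg f σ)
  refine (Finset.sum_le_sum fun σ _ => hterm σ).trans ?_
  rw [ENNReal.ofReal_sum_of_nonneg fun σ _ =>
    mul_nonneg hC0 (mul_nonneg (edgeLength_nonneg _) (M.jump_nonneg f σ))]

end PolygonalMesh

/-! ### The Sobolev-Poincaré inequality on parallelograms and on unions -/

/-- The `L²` Sobolev-Poincaré inequality on `U ⊆ Ω`, uniformly over the discrete functions on the
meshes of `Ω`: the squared `L²(U)` distance to the constants is controlled by the square of the
total variation on `Ω`. -/
def SobolevPoincare (Ω U : Set Plane) : Prop :=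
  ∃ C : ℝ, 0 ≤ C ∧ ∀ (T Eint Eext : Type) [Fintype T] [Fintype Eint] [Fintype Eext]
    (M : PolygonalMesh Ω T Eint Eext) (f : T → ℝ), ∃ c : ℝ,
      ∑ K, (volume (M.cell K ∩ U)).toReal * (f K - c) ^ 2 ≤ C * M.variation f ^ 2

namespace PolygonalMesh

variable {Ω : Set Plane} {T Eint Eext : Type*}

/-- Some line avoiding finitely many given ones meets no more jumps than the average line. -/
theorem exists_lineVariation_le [Fintype Eint] (M : PolygonalMesh Ω T Eint Eext) (f : T → ℝ)
    (l : Plane →ₗ[ℝ] ℝ) {C : ℝ} (hC0 : 0 ≤ C) (hC : ∀ z, |l z| ≤ C * ‖z‖) (α : ℝ) {r : ℝ}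
    (hr : 0 < r) {B : Set ℝ} (hB : B.Finite) :
    ∃ s ∈ Set.Ioo α (α + r), s ∉ B ∧ M.lineVariation f l s ≤ C * M.variation f / r := by
  set μ : Measure ℝ := volume.restrict (Set.Ioo α (α + r)) with hμ
  have hμu : μ Set.univ = ENNReal.ofReal r := by simp [hμ]
  have hμ0 : μ ≠ 0 := by
    rw [← Measure.measure_univ_ne_zero, hμu]
    simpa using hr
  have : IsFiniteMeasure μ := ⟨by rw [hμu]; exact ENNReal.ofReal_lt_top⟩
  have hN : μ (B ∪ (Set.Ioo α (α + r))ᶜ) = 0 := by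
    refine measure_union_null (measure_mono_null subset_rfl (hB.measure_zero _)) ?_
    rw [hμ, Measure.restrict_apply measurableSet_Ioo.compl]
    simp
  obtain ⟨s, hs, hle⟩ := exists_notMem_null_le_laverage hμ0
    (M.measurable_lineVariation f l).ennreal_ofReal.aemeasurable hN
  simp only [Set.mem_union, Set.mem_compl_iff, not_or, not_not] at hs
  refine ⟨s, hs.2, hs.1, ?_⟩
  rw [laverage_eq, hμu] at hle
  have h2 := hle.trans (ENNReal.div_le_div_right ((setLIntegral_le_lintegral _ _).trans
    (M.lintegral_lineVariation_le f l hC0 hC)) _)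
  rw [← ENNReal.ofReal_div_of_pos hr] at h2
  exact (ENNReal.ofReal_le_ofReal_iff
    (div_nonneg (mul_nonneg hC0 (M.variation_nonneg f)) hr.le)).1 h2

end PolygonalMesh

open PolygonalMesh in
/-- The Gagliardo-Nirenberg argument. Moving parallel to the sides of the parallelogram to a point
`w` whose two lines carry at most the average number of jumps, in either order of the two
directions, bounds `|f - f w|` by a function of the first coordinate and by a function of the second
one; the product of the two bounds is integrated by Tonelli's theorem. -/
theorem sobolevPoincare_parallelogram {Ω : Set Plane} (hΩ : IsOpen Ω) {x u v : Plane} {r : ℝ}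
    (hr : 0 < r) (h : wedge u v ≠ 0) (hP : parallelogram x u v r ⊆ Ω) :
    SobolevPoincare Ω (parallelogram x u v r) := by
  set L := wedgeEquiv u v h with hL
  set P := parallelogram x u v r with hPdef
  set l₁ : Plane →ₗ[ℝ] ℝ := LinearMap.fst ℝ ℝ ℝ ∘ₗ L.toLinearEquiv.toLinearMap with hl₁
  set l₂ : Plane →ₗ[ℝ] ℝ := LinearMap.snd ℝ ℝ ℝ ∘ₗ L.toLinearEquiv.toLinearMap with hl₂
  have e₁ : ∀ z, l₁ z = (L z).1 := fun _ => rfl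
  have e₂ : ∀ z, l₂ z = (L z).2 := fun _ => rfl
  set N : ℝ := ‖(L : Plane →L[ℝ] ℝ × ℝ)‖ with hN
  have hN0 : 0 ≤ N := norm_nonneg _
  have hb₁ : ∀ z, |l₁ z| ≤ N * ‖z‖ := fun z =>
    (norm_fst_le (L z)).trans ((L : Plane →L[ℝ] ℝ × ℝ).le_opNorm z)
  have hb₂ : ∀ z, |l₂ z| ≤ N * ‖z‖ := fun z =>
    (norm_snd_le (L z)).trans ((L : Plane →L[ℝ] ℝ × ℝ).le_opNorm z)
  set α := l₁ x
  set β := l₂ x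
  set I := Set.Ioo α (α + r)
  set J := Set.Ioo β (β + r)
  have hmem : ∀ z, z ∈ P ↔ l₁ z ∈ I ∧ l₂ z ∈ J := by
    intro z
    rw [hPdef, mem_parallelogram_iff h, ← hL, map_sub]
    simp only [Set.mem_prod, Set.mem_Ioo, Prod.fst_sub, Prod.snd_sub, ← e₁, ← e₂, I, J, α, β]
    constructor
    · rintro ⟨⟨_, _⟩, ⟨_, _⟩⟩
      refine ⟨⟨?_, ?_⟩, ⟨?_, ?_⟩⟩ <;> linarith
    · rintro ⟨⟨_, _⟩, ⟨_, _⟩⟩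
      refine ⟨⟨?_, ?_⟩, ⟨?_, ?_⟩⟩ <;> linarith
  have hPpre : P = L ⁻¹' (I ×ˢ J) := by
    ext z
    rw [hmem]
    rfl
  have hPm : MeasurableSet P := (isOpen_parallelogram h).measurableSet
  have hLm : Measurable L := L.continuous.measurable
  -- the coordinates transport Lebesgue measure to a multiple of Lebesgue measure
  obtain ⟨κ, hκ⟩ : ∃ κ : NNReal,
      (volume : Measure Plane).map L = κ • (volume : Measure (ℝ × ℝ)) := by
    have : ((volume : Measure Plane).map L).IsAddHaarMeasure := L.isAddHaarMeasure_map _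
    exact ⟨_, Measure.isAddLeftInvariant_eq_smul _ _⟩
  refine ⟨κ * (2 * N) ^ 2, by positivity, ?_⟩
  intro T Eint Eext _ _ _ M f
  set V := M.variation f with hV
  have hV0 : 0 ≤ V := M.variation_nonneg f
  set a := N * V / r with ha
  have ha0 : 0 ≤ a := by positivity
  obtain ⟨s', hs'I, hs'B, hs'⟩ := M.exists_lineVariation_le f l₁ hN0 hb₁ α hr
    (M.finite_vertices.image l₁)
  obtain ⟨t', ht'J, ht'B, ht'⟩ := M.exists_lineVariation_le f l₂ hN0 hb₂ β hr
    (M.finite_vertices.image l₂)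
  have hsymm : ∀ s t, l₁ (L.symm (s, t)) = s ∧ l₂ (L.symm (s, t)) = t := fun s t => by
    rw [e₁, e₂, L.apply_symm_apply]
    exact ⟨rfl, rfl⟩
  have hsP : ∀ s ∈ I, ∀ t ∈ J, L.symm (s, t) ∈ P := fun s hs t ht => by
    rw [hmem, (hsymm s t).1, (hsymm s t).2]
    exact ⟨hs, ht⟩
  have hseg : ∀ z ∈ P, ∀ w ∈ P, segment ℝ z w ⊆ Ω := fun z hz w hw =>
    ((convex_parallelogram x u v r).segment_subset hz hw).trans hP
  obtain ⟨K', hK'⟩ := M.exists_mem_closure_cell (hP (hsP s' hs'I t' ht'J))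
  refine ⟨f K', ?_⟩
  have hvert : ∀ (l : Plane →ₗ[ℝ] ℝ) (s : ℝ), s ∉ l '' M.vertices → ∀ p ∈ M.vertices, l p ≠ s :=
    fun l s hs p hp he => hs ⟨p, hp, he⟩
  have hpt : ∀ z ∈ P, l₁ z ∉ l₁ '' M.vertices → l₂ z ∉ l₂ '' M.vertices → ∀ K, z ∈ M.cell K →
      (f K - f K') ^ 2 ≤ (M.lineVariation f l₁ (l₁ z) + a) * (M.lineVariation f l₂ (l₂ z) + a) := by
    intro z hz h1 h2 K hK
    have hzI := ((hmem z).1 hz).1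
    have hzJ := ((hmem z).1 hz).2
    have A : |f K - f K'| ≤ M.lineVariation f l₁ (l₁ z) + a := by
      have hq := hsP _ hzI _ ht'J
      obtain ⟨K₁, hK₁⟩ := M.exists_mem_closure_cell (hP hq)
      have b1 := M.abs_sub_le_lineVariation hΩ f (hvert l₁ _ h1) (hseg z hz _ hq) rfl
        (hsymm _ _).1 (subset_closure hK) hK₁
      have b2 := M.abs_sub_le_lineVariation hΩ f (hvert l₂ _ ht'B)
        (hseg _ hq _ (hsP s' hs'I t' ht'J)) (hsymm _ _).2 (hsymm _ _).2 hK₁ hK'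
      exact (abs_sub_le _ _ _).trans (add_le_add b1 (b2.trans ht'))
    have B : |f K - f K'| ≤ M.lineVariation f l₂ (l₂ z) + a := by
      have hq := hsP _ hs'I _ hzJ
      obtain ⟨K₁, hK₁⟩ := M.exists_mem_closure_cell (hP hq)
      have b1 := M.abs_sub_le_lineVariation hΩ f (hvert l₂ _ h2) (hseg z hz _ hq) rfl
        (hsymm _ _).2 (subset_closure hK) hK₁
      have b2 := M.abs_sub_le_lineVariation hΩ f (hvert l₁ _ hs'B)
        (hseg _ hq _ (hsP s' hs'I t' ht'J)) (hsymm _ _).1 (hsymm _ _).1 hK₁ hK'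
      exact (abs_sub_le _ _ _).trans (add_le_add b1 (b2.trans hs'))
    rw [← sq_abs, sq]
    exact mul_le_mul A B (abs_nonneg _) ((abs_nonneg _).trans A)
  set H : ℝ × ℝ → ENNReal := fun p => ENNReal.ofReal (M.lineVariation f l₁ p.1 + a) *
    ENNReal.ofReal (M.lineVariation f l₂ p.2 + a) with hH
  have hm₁ : Measurable fun s => ENNReal.ofReal (M.lineVariation f l₁ s + a) :=
    ((M.measurable_lineVariation f l₁).add_const a).ennreal_ofReal
  have hm₂ : Measurable fun s => ENNReal.ofReal (M.lineVariation f l₂ s + a) :=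
    ((M.measurable_lineVariation f l₂).add_const a).ennreal_ofReal
  have hHm : Measurable H := (hm₁.comp measurable_fst).mul (hm₂.comp measurable_snd)
  have hnull : ∀ S : Set (ℝ × ℝ), MeasurableSet S → volume S = 0 →
      volume (L ⁻¹' S) = 0 := by
    intro S hS h0
    rw [← Measure.map_apply hLm hS, hκ, Measure.smul_apply, h0, smul_zero]
  have hae₁ : ∀ᵐ z : Plane, l₁ z ∉ l₁ '' M.vertices := by
    have := hnull ((l₁ '' M.vertices) ×ˢ Set.univ)
      ((M.finite_vertices.image l₁).measurableSet.prod MeasurableSet.univ)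
      (by rw [Measure.volume_eq_prod, Measure.prod_prod,
            (M.finite_vertices.image l₁).measure_zero, zero_mul])
    rw [ae_iff]
    refine measure_mono_null (fun z hz => ?_) this
    exact ⟨not_not.1 hz, trivial⟩
  have hae₂ : ∀ᵐ z : Plane, l₂ z ∉ l₂ '' M.vertices := by
    have := hnull (Set.univ ×ˢ (l₂ '' M.vertices))
      (MeasurableSet.univ.prod (M.finite_vertices.image l₂).measurableSet)
      (by rw [Measure.volume_eq_prod, Measure.prod_prod,
            (M.finite_vertices.image l₂).measure_zero, mul_zero])
    rw [ae_iff]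
    refine measure_mono_null (fun z hz => ?_) this
    exact ⟨trivial, not_not.1 hz⟩
  have hKm : ∀ K, MeasurableSet (M.cell K ∩ P) := fun K => (M.isOpen_cell K).measurableSet.inter hPm
  have hcell : ∀ K, volume (M.cell K ∩ P) * ENNReal.ofReal ((f K - f K') ^ 2)
      ≤ ∫⁻ z in M.cell K ∩ P, H (L z) := by
    intro K
    rw [mul_comm, ← setLIntegral_const]
    refine setLIntegral_mono_ae (hHm.comp hLm).aemeasurable ?_
    filter_upwards [hae₁, hae₂] with z h1 h2 hz
    rw [hH]
    dsimp only
    rw [← ENNReal.ofReal_mul (add_nonneg (M.lineVariation_nonneg f l₁ _) ha0)]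
    exact ENNReal.ofReal_le_ofReal (hpt z hz.2 h1 h2 K hz.1)
  have hint : ∀ (l : Plane →ₗ[ℝ] ℝ) (γ : ℝ), (∀ z, |l z| ≤ N * ‖z‖) →
      ∫⁻ s in Set.Ioo γ (γ + r), ENNReal.ofReal (M.lineVariation f l s + a)
        ≤ ENNReal.ofReal (2 * N * V) := by
    intro l γ hl
    simp_rw [fun s => ENNReal.ofReal_add (M.lineVariation_nonneg f l s) ha0]
    rw [lintegral_add_right _ measurable_const, setLIntegral_const, Real.volume_Ioo,
      ← ENNReal.ofReal_mul ha0]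
    have h1 := (setLIntegral_le_lintegral (Set.Ioo γ (γ + r)) _).trans
      (M.lintegral_lineVariation_le f l hN0 hl)
    refine (add_le_add_left h1 _).trans ?_
    rw [← ENNReal.ofReal_add (by positivity) (by rw [add_sub_cancel_left]; positivity)]
    apply ENNReal.ofReal_le_ofReal
    rw [add_sub_cancel_left, ha, div_mul_cancel₀ _ hr.ne']
    linarith
  have htotal : ∑ K, volume (M.cell K ∩ P) * ENNReal.ofReal ((f K - f K') ^ 2)
      ≤ ENNReal.ofReal (κ * (2 * N) ^ 2 * V ^ 2) := by
    calc ∑ K, volume (M.cell K ∩ P) * ENNReal.ofReal ((f K - f K') ^ 2)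
        ≤ ∑ K, ∫⁻ z in M.cell K ∩ P, H (L z) := Finset.sum_le_sum fun K _ => hcell K
      _ = ∫⁻ z in ⋃ K, M.cell K ∩ P, H (L z) := by
          rw [lintegral_iUnion hKm, tsum_fintype]
          intro K K₂ hKK
          exact (M.disjoint_cell K K₂ hKK).mono Set.inter_subset_left Set.inter_subset_left
      _ ≤ ∫⁻ z in P, H (L z) :=
          lintegral_mono_set (Set.iUnion_subset fun K => Set.inter_subset_right)
      _ = ∫⁻ p in I ×ˢ J, H p ∂((volume : Measure Plane).map L) := by
          rw [setLIntegral_map (measurableSet_Ioo.prod measurableSet_Ioo) hHm hLm, hPpre]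
      _ = κ * ((∫⁻ s in I, ENNReal.ofReal (M.lineVariation f l₁ s + a)) *
            ∫⁻ t in J, ENNReal.ofReal (M.lineVariation f l₂ t + a)) := by
          rw [hκ, Measure.restrict_smul, lintegral_smul_measure, Measure.volume_eq_prod,
            ← Measure.prod_restrict, hH, lintegral_prod_mul hm₁.aemeasurable hm₂.aemeasurable]
          rfl
      _ ≤ κ * (ENNReal.ofReal (2 * N * V) * ENNReal.ofReal (2 * N * V)) := by
          gcongr
          · exact hint l₁ α hb₁
          · exact hint l₂ β hb₂
      _ = ENNReal.ofReal (κ * (2 * N) ^ 2 * V ^ 2) := by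
          rw [← ENNReal.ofReal_mul (by positivity), ← ENNReal.ofReal_coe_nnreal,
            ← ENNReal.ofReal_mul (by positivity)]
          congr 1
          ring
  have hreal := ENNReal.toReal_mono ENNReal.ofReal_ne_top htotal
  rw [ENNReal.toReal_ofReal (by positivity), ENNReal.toReal_sum] at hreal
  · simpa only [ENNReal.toReal_mul, ENNReal.toReal_ofReal (sq_nonneg _)] using hreal
  · intro K hK
    exact ((Finset.single_le_sum (f := fun K => volume (M.cell K ∩ P) *
      ENNReal.ofReal ((f K - f K') ^ 2)) (fun _ _ => zero_le) hK).trans_lt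
        (htotal.trans_lt ENNReal.ofReal_lt_top)).ne

namespace PolygonalMesh

variable {Ω : Set Plane} {T Eint Eext : Type*}

/-- The control volumes exhaust `Ω` up to a null set. -/
theorem sum_volume_cell_inter [Fintype T] [Finite Eint] (M : PolygonalMesh Ω T Eint Eext)
    (hΩ : IsOpen Ω) (hb : Bornology.IsBounded Ω) {W : Set Plane} (hW : MeasurableSet W)
    (hWΩ : W ⊆ Ω) : ∑ K, (volume (M.cell K ∩ W)).toReal = (volume W).toReal := by
  have hfin : volume W ≠ ⊤ := (hb.subset hWΩ).measure_lt_top.ne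
  rw [← ENNReal.toReal_sum fun K _ => measure_ne_top_of_subset Set.inter_subset_right hfin]
  congr 1
  have h1 : volume (⋃ K, M.cell K ∩ W) = ∑ K, volume (M.cell K ∩ W) := by
    rw [measure_iUnion _ fun K => (M.isOpen_cell K).measurableSet.inter hW, tsum_fintype]
    intro K L hKL
    exact (M.disjoint_cell K L hKL).mono Set.inter_subset_left Set.inter_subset_left
  rw [← h1, ← Set.iUnion_inter]
  apply measure_congr
  refine Set.inter_subset_right.eventuallyLE.antisymm (ae_le_set.2 ?_)
  refine measure_mono_null ?_ (M.volume_diff_iUnion_cell hΩ)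
  rintro z ⟨hz, hz'⟩
  exact ⟨hWΩ hz, fun h => hz' ⟨h, hz⟩⟩

end PolygonalMesh

/-- Two overlapping sets with the Sobolev-Poincaré inequality: the optimal constants on the two sets
are close to each other, since both are close to the function on the overlap. -/
theorem SobolevPoincare.union {Ω U V : Set Plane} (hΩ : IsOpen Ω) (hb : Bornology.IsBounded Ω)
    (hU : SobolevPoincare Ω U) (hV : SobolevPoincare Ω V) (hUo : IsOpen U) (hVo : IsOpen V)
    (hUΩ : U ⊆ Ω) (hVΩ : V ⊆ Ω) (hUV : (U ∩ V).Nonempty) : SobolevPoincare Ω (U ∪ V) := by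
  obtain ⟨C₁, h₁, HU⟩ := hU
  obtain ⟨C₂, h₂, HV⟩ := hV
  set δ : ℝ := (volume (U ∩ V)).toReal with hδ
  set v : ℝ := (volume V).toReal with hv
  have hfinU : volume U ≠ ⊤ := (hb.subset hUΩ).measure_lt_top.ne
  have hfinV : volume V ≠ ⊤ := (hb.subset hVΩ).measure_lt_top.ne
  have hδ0 : 0 < δ := ENNReal.toReal_pos ((hUo.inter hVo).measure_pos _ hUV).ne'
    (measure_ne_top_of_subset Set.inter_subset_left hfinU)
  have hv0 : 0 ≤ v := ENNReal.toReal_nonneg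
  refine ⟨C₁ + 2 * C₂ + 2 * v * (2 * (C₁ + C₂) / δ), by positivity, ?_⟩
  intro T Eint Eext _ _ _ M f
  obtain ⟨c₁, hc₁⟩ := HU T Eint Eext M f
  obtain ⟨c₂, hc₂⟩ := HV T Eint Eext M f
  refine ⟨c₁, ?_⟩
  have hfin : ∀ K, ∀ W : Set Plane, volume W ≠ ⊤ → volume (M.cell K ∩ W) ≠ ⊤ := fun K W hW =>
    measure_ne_top_of_subset Set.inter_subset_right hW
  have hdU : ∀ K, (volume (M.cell K ∩ (U ∩ V))).toReal ≤ (volume (M.cell K ∩ U)).toReal := fun K =>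
    ENNReal.toReal_mono (hfin K U hfinU)
      (measure_mono (Set.inter_subset_inter_right _ Set.inter_subset_left))
  have hdV : ∀ K, (volume (M.cell K ∩ (U ∩ V))).toReal ≤ (volume (M.cell K ∩ V)).toReal := fun K =>
    ENNReal.toReal_mono (hfin K V hfinV)
      (measure_mono (Set.inter_subset_inter_right _ Set.inter_subset_right))
  have he : ∀ K, (volume (M.cell K ∩ (U ∪ V))).toReal
      ≤ (volume (M.cell K ∩ U)).toReal + (volume (M.cell K ∩ V)).toReal := fun K => by
    rw [← ENNReal.toReal_add (hfin K U hfinU) (hfin K V hfinV), Set.inter_union_distrib_left]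
    exact ENNReal.toReal_mono (ENNReal.add_ne_top.2 ⟨hfin K U hfinU, hfin K V hfinV⟩)
      (measure_union_le _ _)
  have hsq : ∀ a b : ℝ, (a + b) ^ 2 ≤ 2 * a ^ 2 + 2 * b ^ 2 := fun a b => by
    nlinarith [sq_nonneg (a - b)]
  have hsumδ := M.sum_volume_cell_inter hΩ hb (hUo.inter hVo).measurableSet
    (Set.inter_subset_left.trans hUΩ)
  have hsumv := M.sum_volume_cell_inter hΩ hb hVo.measurableSet hVΩ
  set X := M.variation f ^ 2
  have hc : (c₂ - c₁) ^ 2 ≤ 2 * (C₁ + C₂) / δ * X := by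
    rw [div_mul_eq_mul_div, le_div_iff₀ hδ0, mul_comm, hδ, ← hsumδ, Finset.sum_mul]
    calc ∑ K, (volume (M.cell K ∩ (U ∩ V))).toReal * (c₂ - c₁) ^ 2
        ≤ ∑ K, (2 * ((volume (M.cell K ∩ U)).toReal * (f K - c₁) ^ 2)
            + 2 * ((volume (M.cell K ∩ V)).toReal * (f K - c₂) ^ 2)) := by
          refine Finset.sum_le_sum fun K _ => ?_
          have h := hsq (f K - c₁) (-(f K - c₂))
          rw [show f K - c₁ + -(f K - c₂) = c₂ - c₁ by ring, neg_sq] at h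
          have h3 := mul_le_mul_of_nonneg_left h
            (ENNReal.toReal_nonneg (a := volume (M.cell K ∩ (U ∩ V))))
          have h4 := mul_le_mul_of_nonneg_right (hdU K) (sq_nonneg (f K - c₁))
          have h5 := mul_le_mul_of_nonneg_right (hdV K) (sq_nonneg (f K - c₂))
          linarith
      _ ≤ 2 * (C₁ + C₂) * X := by
          rw [Finset.sum_add_distrib, ← Finset.mul_sum, ← Finset.mul_sum]
          linarith
  calc ∑ K, (volume (M.cell K ∩ (U ∪ V))).toReal * (f K - c₁) ^ 2
      ≤ ∑ K, ((volume (M.cell K ∩ U)).toReal * (f K - c₁) ^ 2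
          + (2 * ((volume (M.cell K ∩ V)).toReal * (f K - c₂) ^ 2)
            + (volume (M.cell K ∩ V)).toReal * (2 * (c₂ - c₁) ^ 2))) := by
        refine Finset.sum_le_sum fun K _ => ?_
        have h := hsq (f K - c₂) (c₂ - c₁)
        rw [sub_add_sub_cancel] at h
        have h3 := mul_le_mul_of_nonneg_left h
          (ENNReal.toReal_nonneg (a := volume (M.cell K ∩ V)))
        have h4 := mul_le_mul_of_nonneg_right (he K) (sq_nonneg (f K - c₁))
        linarith
    _ ≤ C₁ * X + (2 * (C₂ * X) + v * (2 * (2 * (C₁ + C₂) / δ * X))) := by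
        rw [Finset.sum_add_distrib, Finset.sum_add_distrib, ← Finset.mul_sum, ← Finset.sum_mul,
          hsumv]
        gcongr
    _ = (C₁ + 2 * C₂ + 2 * v * (2 * (C₁ + C₂) / δ)) * X := by ring

theorem SobolevPoincare.of_ae_subset {Ω U W : Set Plane} (hU : SobolevPoincare Ω U)
    (hfin : volume U ≠ ⊤) (h : volume (W \ U) = 0) : SobolevPoincare Ω W := by
  obtain ⟨C, hC, H⟩ := hU
  refine ⟨C, hC, fun T Eint Eext _ _ _ M f => ?_⟩
  obtain ⟨c, hc⟩ := H T Eint Eext M f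
  refine ⟨c, (Finset.sum_le_sum fun K _ => ?_).trans hc⟩
  refine mul_le_mul_of_nonneg_right (ENNReal.toReal_mono
    (measure_ne_top_of_subset Set.inter_subset_right hfin) ?_) (sq_nonneg _)
  calc volume (M.cell K ∩ W) ≤ volume (M.cell K ∩ U ∪ W \ U) := by
        apply measure_mono
        rintro z ⟨h1, h2⟩
        by_cases h3 : z ∈ U
        · exact Or.inl ⟨h1, h3⟩
        · exact Or.inr ⟨h2, h3⟩
    _ ≤ volume (M.cell K ∩ U) + volume (W \ U) := measure_union_le _ _
    _ = volume (M.cell K ∩ U) := by rw [h, add_zero]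

theorem wedge_unit : wedge (!₂[1, 0] : Plane) !₂[0, 1] = 1 := by simp [wedge]

theorem exists_sobolevPoincare_nhds {Ω : Set Plane} (hΩ : IsOpen Ω) {y : Plane} (hy : y ∈ Ω) :
    ∃ B, IsOpen B ∧ B ⊆ Ω ∧ y ∈ B ∧ SobolevPoincare Ω B := by
  obtain ⟨ρ, hρ, hball⟩ := Metric.isOpen_iff.1 hΩ y hy
  have h0 : wedge (!₂[1, 0] : Plane) !₂[0, 1] ≠ 0 := by rw [wedge_unit]; exact one_ne_zero
  set r := ρ / 2 with hr
  have hr0 : 0 < r := by positivity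
  set x : Plane := y - !₂[r / 2, r / 2] with hx
  have hsub : parallelogram x !₂[1, 0] !₂[0, 1] r ⊆ Ω := by
    rintro _ ⟨s, t, hs, hs', ht, ht', rfl⟩
    apply hball
    rw [Metric.mem_ball, dist_eq_norm]
    have e : x + (s • (!₂[1, 0] : Plane) + t • !₂[0, 1]) - y = !₂[s - r / 2, t - r / 2] := by
      ext i
      fin_cases i <;> simp [hx] <;> ring
    rw [e, EuclideanSpace.norm_eq, Real.sqrt_lt' hρ]
    simp only [Fin.sum_univ_two, Real.norm_eq_abs, sq_abs, Matrix.cons_val_zero,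
      Matrix.cons_val_one]
    have h1 : (s - r / 2) ^ 2 ≤ r ^ 2 := by nlinarith
    have h2 : (t - r / 2) ^ 2 ≤ r ^ 2 := by nlinarith
    nlinarith
  refine ⟨_, isOpen_parallelogram h0, hsub, ?_, sobolevPoincare_parallelogram hΩ hr0 h0 hsub⟩
  refine ⟨r / 2, r / 2, by linarith, by linarith, by linarith, by linarith, ?_⟩
  ext i
  fin_cases i <;> simp [hx]

/-- In a connected open set, any two points lie in a common open subset that satisfies the
Sobolev-Poincaré inequality. -/
theorem exists_sobolevPoincare_of_mem {Ω : Set Plane} (hΩ : IsOpen Ω)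
    (hc : IsPreconnected Ω) (hb : Bornology.IsBounded Ω) {x y : Plane} (hx : x ∈ Ω) (hy : y ∈ Ω) :
    ∃ U, IsOpen U ∧ U ⊆ Ω ∧ x ∈ U ∧ y ∈ U ∧ SobolevPoincare Ω U := by
  set S : Set Plane := {y | ∃ U, IsOpen U ∧ U ⊆ Ω ∧ x ∈ U ∧ y ∈ U ∧ SobolevPoincare Ω U} with hS
  have hSo : IsOpen S := by
    rw [isOpen_iff_mem_nhds]
    rintro z ⟨U, hU, hUΩ, hxU, hzU, h⟩
    exact Filter.mem_of_superset (hU.mem_nhds hzU) fun w hw => ⟨U, hU, hUΩ, hxU, hw, h⟩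
  have hsub : Ω ⊆ S := by
    refine hc.subset_of_closure_inter_subset hSo ⟨x, hx, ?_⟩ ?_
    · obtain ⟨B, hBo, hBΩ, hxB, hB⟩ := exists_sobolevPoincare_nhds hΩ hx
      exact ⟨B, hBo, hBΩ, hxB, hxB, hB⟩
    · rintro z ⟨hz, hzΩ⟩
      obtain ⟨B, hBo, hBΩ, hzB, hB⟩ := exists_sobolevPoincare_nhds hΩ hzΩ
      obtain ⟨w, hwB, U, hU, hUΩ, hxU, hwU, h⟩ := mem_closure_iff.1 hz B hBo hzB
      exact ⟨U ∪ B, hU.union hBo, Set.union_subset hUΩ hBΩ, Or.inl hxU, Or.inr hzB,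
        h.union hΩ hb hB hU hBo hUΩ hBΩ ⟨w, hwU, hwB⟩⟩
  exact hsub hy

/-- If a connected open set is covered almost everywhere by finitely many open subsets with the
Sobolev-Poincaré inequality, then it satisfies the inequality itself. -/
theorem sobolevPoincare_of_ae_cover {Ω : Set Plane} (hΩ : IsOpen Ω) (hc : IsConnected Ω)
    (hb : Bornology.IsBounded Ω) {ℬ : Set (Set Plane)} (hfin : ℬ.Finite)
    (h : ∀ B ∈ ℬ, IsOpen B ∧ B ⊆ Ω ∧ SobolevPoincare Ω B) (hcover : volume (Ω \ ⋃₀ ℬ) = 0) :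
    SobolevPoincare Ω Ω := by
  obtain ⟨x, hx⟩ := hc.nonempty
  have key : ∃ U, IsOpen U ∧ U ⊆ Ω ∧ x ∈ U ∧ ⋃₀ ℬ ⊆ U ∧ SobolevPoincare Ω U := by
    clear hcover
    induction ℬ, hfin using Set.Finite.induction_on with
    | empty =>
      obtain ⟨U, hU, hUΩ, hxU, hSU⟩ := exists_sobolevPoincare_nhds hΩ hx
      exact ⟨U, hU, hUΩ, hxU, by simp, hSU⟩
    | @insert B ℬ hB _ ih =>
      obtain ⟨U, hU, hUΩ, hxU, hℬ, hSU⟩ := ih fun B' hB' => h B' (Set.mem_insert_of_mem _ hB')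
      obtain ⟨hBo, hBΩ, hSB⟩ := h B (Set.mem_insert _ _)
      rcases B.eq_empty_or_nonempty with rfl | ⟨y, hy⟩
      · exact ⟨U, hU, hUΩ, hxU, by simpa using hℬ, hSU⟩
      obtain ⟨W, hW, hWΩ, hxW, hyW, hSW⟩ :=
        exists_sobolevPoincare_of_mem hΩ hc.isPreconnected hb hx (hBΩ hy)
      refine ⟨(U ∪ W) ∪ B, (hU.union hW).union hBo,
        Set.union_subset (Set.union_subset hUΩ hWΩ) hBΩ, Or.inl (Or.inl hxU), ?_, ?_⟩
      · rw [Set.sUnion_insert, Set.union_subset_iff]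
        exact ⟨Set.subset_union_right, hℬ.trans
          (Set.subset_union_left.trans Set.subset_union_left)⟩
      · exact (hSU.union hΩ hb hSW hU hW hUΩ hWΩ ⟨x, hxU, hxW⟩).union hΩ hb hSB (hU.union hW) hBo
          (Set.union_subset hUΩ hWΩ) hBΩ ⟨y, Or.inr hyW, hy⟩
  obtain ⟨U, -, hUΩ, -, hℬU, hSU⟩ := key
  exact hSU.of_ae_subset (hb.subset hUΩ).measure_lt_top.ne
    (measure_mono_null (Set.sdiff_subset_sdiff_right hℬU) hcover)

/-! ### Covering a polygonal domain by parallelograms -/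

/-- The open convex cone spanned by two vectors. -/
def openCone (u v : Plane) : Set Plane := {h | ∃ s t : ℝ, 0 < s ∧ 0 < t ∧ h = s • u + t • v}

theorem openCone_comm (u v : Plane) : openCone u v = openCone v u := by
  ext h
  constructor <;> rintro ⟨s, t, hs, ht, rfl⟩ <;> exact ⟨t, s, ht, hs, add_comm _ _⟩

theorem openCone_subset {u v w : Plane} (hw : w ∈ openCone u v) : openCone u w ⊆ openCone u v := by
  obtain ⟨a, b, ha, hb, rfl⟩ := hw
  rintro _ ⟨s, t, hs, ht, rfl⟩
  exact ⟨s + t * a, t * b, by positivity, by positivity, by module⟩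

theorem notMem_openCone_right {u w : Plane} (h : wedge u w ≠ 0) : w ∉ openCone u w := by
  rintro ⟨c, d, hc, -, he⟩
  have h1 := congrArg (fun z => wedge z w) he
  simp only [wedge_add_left, wedge_smul_left, wedge_self, mul_zero, add_zero] at h1
  exact (mul_ne_zero hc.ne' h) h1.symm

/-- A ray strictly inside an open cone cuts it into two open cones. -/
theorem mem_openCone_of_mem {u v w h : Plane} (hw : w ∈ openCone u v) (hh : h ∈ openCone u v)
    (hray : ∀ k : ℝ, h ≠ k • w) : h ∈ openCone u w ∨ h ∈ openCone v w := by
  obtain ⟨a, b, ha, hb, rfl⟩ := hw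
  obtain ⟨s, t, hs, ht, rfl⟩ := hh
  rcases lt_trichotomy (s * b) (t * a) with h1 | h1 | h1
  · right
    refine ⟨t - s / a * b, s / a, ?_, by positivity, ?_⟩
    · rw [sub_pos, div_mul_eq_mul_div, div_lt_iff₀ ha]
      exact h1
    · rw [smul_add, smul_smul, div_mul_cancel₀ _ ha.ne']
      module
  · refine absurd ?_ (hray (s / a))
    rw [smul_add, smul_smul, smul_smul, div_mul_cancel₀ _ ha.ne', div_mul_eq_mul_div, h1,
      mul_div_cancel_right₀ _ ha.ne']
  · left
    refine ⟨s - t / b * a, t / b, ?_, by positivity, ?_⟩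
    · rw [sub_pos, div_mul_eq_mul_div, div_lt_iff₀ hb]
      exact h1
    · rw [smul_add, smul_smul, smul_smul, div_mul_cancel₀ _ hb.ne']
      module

/-- Given finitely many directions, a vector on none of their lines that lies in some open cone
spanned by two of them lies in such a cone whose interior contains none of the directions. -/
theorem exists_minimal_openCone (D : Finset Plane) {h : Plane}
    (hray : ∀ w ∈ D, ∀ k : ℝ, h ≠ k • w)
    (hex : ∃ u ∈ D, ∃ v ∈ D, wedge u v ≠ 0 ∧ h ∈ openCone u v) :
    ∃ u ∈ D, ∃ v ∈ D, wedge u v ≠ 0 ∧ h ∈ openCone u v ∧ ∀ w ∈ D, w ∉ openCone u v := by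
  classical
  set Q := (D ×ˢ D).filter fun q => wedge q.1 q.2 ≠ 0 ∧ h ∈ openCone q.1 q.2 with hQ
  have hQmem : ∀ u v, (u, v) ∈ Q ↔ (u ∈ D ∧ v ∈ D) ∧ wedge u v ≠ 0 ∧ h ∈ openCone u v := by
    intro u v
    simp [hQ]
  have hQne : Q.Nonempty := by
    obtain ⟨u, hu, v, hv, h1, h2⟩ := hex
    exact ⟨(u, v), (hQmem u v).2 ⟨⟨hu, hv⟩, h1, h2⟩⟩
  obtain ⟨⟨u, v⟩, huv, hmin⟩ := Finset.exists_min_image Q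
    (fun q => (D.filter fun w => w ∈ openCone q.1 q.2).card) hQne
  obtain ⟨⟨hu, hv⟩, hne, hcone⟩ := (hQmem u v).1 huv
  refine ⟨u, hu, v, hv, hne, hcone, fun w hw hwc => ?_⟩
  have hdesc : ∀ u' ∈ D, wedge u' w ≠ 0 → openCone u' w ⊆ openCone u v → h ∉ openCone u' w := by
    intro u' hu' hne' hsub hh
    refine absurd (hmin (u', w) ((hQmem _ _).2 ⟨⟨hu', hw⟩, hne', hh⟩)) (not_le.2 ?_)
    apply Finset.card_lt_card
    rw [Finset.ssubset_iff_of_subset]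
    · exact ⟨w, Finset.mem_filter.2 ⟨hw, hwc⟩, fun hmem =>
        notMem_openCone_right hne' (Finset.mem_filter.1 hmem).2⟩
    · intro p hp
      exact Finset.mem_filter.2 ⟨(Finset.mem_filter.1 hp).1, hsub (Finset.mem_filter.1 hp).2⟩
  obtain ⟨a, b, ha, hb, hab⟩ := id hwc
  rcases mem_openCone_of_mem hwc hcone (hray w hw) with h1 | h1
  · refine hdesc u hu ?_ (openCone_subset hwc) h1
    rw [hab, wedge_add_right, wedge_smul_right, wedge_smul_right, wedge_self, mul_zero, zero_add]
    exact mul_ne_zero hb.ne' hne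
  · refine hdesc v hv ?_ ?_ h1
    · rw [hab, wedge_add_right, wedge_smul_right, wedge_smul_right, wedge_self, mul_zero, add_zero,
        wedge_comm v u]
      exact mul_ne_zero ha.ne' (neg_ne_zero.2 hne)
    · rw [openCone_comm u v] at hwc ⊢
      exact openCone_subset hwc

/-- From a point of a segment, the rest of the segment is seen in the directions of its end
points. -/
theorem eq_or_exists_ray_of_mem_segment {a b x p : Plane} (hx : x ∈ segment ℝ a b)
    (hp : p ∈ segment ℝ a b) :
    p = x ∨ ∃ k : ℝ, 0 < k ∧ (p = x + k • (a - x) ∨ p = x + k • (b - x)) := by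
  rw [segment_eq_image'] at hx hp
  obtain ⟨θ, ⟨hθ0, hθ1⟩, rfl⟩ := hx
  obtain ⟨η, ⟨hη0, hη1⟩, rfl⟩ := hp
  dsimp only
  rcases lt_trichotomy η θ with h | h | h
  · right
    have hθ : 0 < θ := hη0.trans_lt h
    refine ⟨(θ - η) / θ, div_pos (by linarith) hθ, Or.inl ?_⟩
    have e : η = θ - (θ - η) / θ * θ := by rw [div_mul_cancel₀ _ hθ.ne']; ring
    nth_rewrite 1 [e]
    module
  · left
    rw [h]
  · right
    have hθ : 0 < 1 - θ := by linarith
    refine ⟨(η - θ) / (1 - θ), div_pos (by linarith) hθ, Or.inr ?_⟩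
    have e : η = θ + (η - θ) / (1 - θ) * (1 - θ) := by rw [div_mul_cancel₀ _ hθ.ne']; ring
    nth_rewrite 1 [e]
    module

/-- Near any point `x`, a set with polygonal boundary is covered, up to a null set, by finitely many
parallelograms with corner `x` that it contains. -/
theorem exists_local_parallelogram_cover {Ω : Set Plane} (S : Finset (Plane × Plane))
    (hS : frontier Ω = ⋃ s ∈ S, segment ℝ s.1 s.2) (hΩ : IsOpen Ω) (x : Plane) :
    ∃ N ∈ nhds x, ∃ ℬ : Set (Set Plane), ℬ.Finite ∧
      (∀ B ∈ ℬ, ∃ u v r, 0 < r ∧ wedge u v ≠ 0 ∧ B = parallelogram x u v r ∧ B ⊆ Ω) ∧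
      volume ((Ω ∩ N) \ ⋃₀ ℬ) = 0 := by
  classical
  set D : Finset Plane := (S.image (fun s => s.1 - x) ∪ S.image (fun s => s.2 - x)) ∪
    {!₂[1, 0], !₂[-1, 0], !₂[0, 1], !₂[0, -1]} with hD
  -- near `x` the boundary consists of pieces of rays starting at `x`
  obtain ⟨δ, hδ, hδS⟩ : ∃ δ > 0, ∀ p ∈ Metric.ball x δ, p ∈ frontier Ω →
      p = x ∨ ∃ w ∈ D, ∃ k : ℝ, 0 < k ∧ p = x + k • w := by
    set F : Set Plane := ⋃ s ∈ {s | s ∈ S ∧ x ∉ segment ℝ s.1 s.2}, segment ℝ s.1 s.2 with hF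
    have hFc : IsClosed F := by
      refine Set.Finite.isClosed_biUnion ?_ fun s _ => PolygonalMesh.isClosed_edgeSet s
      exact S.finite_toSet.subset fun s hs => hs.1
    have hxF : x ∉ F := by
      simp only [hF, Set.mem_iUnion, not_exists]
      exact fun s hs => hs.2
    obtain ⟨δ, hδ, hball⟩ := Metric.isOpen_iff.1 hFc.isOpen_compl x hxF
    refine ⟨δ, hδ, fun p hp hpΩ => ?_⟩
    rw [hS] at hpΩ
    simp only [Set.mem_iUnion] at hpΩ
    obtain ⟨s, hs, hps⟩ := hpΩ
    by_cases hxs : x ∈ segment ℝ s.1 s.2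
    · rcases eq_or_exists_ray_of_mem_segment hxs hps with h | ⟨k, hk, h | h⟩
      · exact Or.inl h
      · refine Or.inr ⟨_, ?_, k, hk, h⟩
        exact Finset.mem_union_left _ (Finset.mem_union_left _ (Finset.mem_image_of_mem _ hs))
      · refine Or.inr ⟨_, ?_, k, hk, h⟩
        exact Finset.mem_union_left _ (Finset.mem_union_right _
          (Finset.mem_image_of_mem (fun s : Plane × Plane => s.2 - x) hs))
    · exact absurd (Set.mem_biUnion (show s ∈ {s | s ∈ S ∧ x ∉ segment ℝ s.1 s.2} from ⟨hs, hxs⟩)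
        hps) (hball hp)
  set R : ℝ := ∑ w ∈ D, ‖w‖ with hR
  have hR0 : 0 ≤ R := Finset.sum_nonneg fun w _ => norm_nonneg w
  have hDR : ∀ w ∈ D, ‖w‖ ≤ R := fun w hw =>
    Finset.single_le_sum (f := fun w : Plane => ‖w‖) (fun w _ => norm_nonneg w) hw
  set r : ℝ := δ / (2 * (R + 1)) with hr
  have hr0 : 0 < r := by positivity
  have hrδ : 2 * r * R < δ := by
    have : 2 * r * (R + 1) = δ := by rw [hr]; field_simp
    nlinarith
  have hPball : ∀ u ∈ D, ∀ v ∈ D, parallelogram x u v r ⊆ Metric.ball x δ := by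
    rintro u hu v hv _ ⟨s, t, hs, hs', ht, ht', rfl⟩
    rw [Metric.mem_ball, dist_eq_norm, add_sub_cancel_left]
    calc ‖s • u + t • v‖ ≤ s * ‖u‖ + t * ‖v‖ := by
          refine (norm_add_le _ _).trans ?_
          rw [norm_smul, norm_smul, Real.norm_of_nonneg hs.le, Real.norm_of_nonneg ht.le]
      _ ≤ r * R + r * R := by
          gcongr
          exacts [hDR u hu, hDR v hv]
      _ < δ := by linarith
  set N : Set Plane := {z | ∀ q ∈ D ×ˢ D, |wedge (z - x) q.2 / wedge q.1 q.2| < r ∧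
    |wedge q.1 (z - x) / wedge q.1 q.2| < r} with hN
  have hNx : N ∈ nhds x := by
    have : ∀ᶠ z in nhds x, ∀ q ∈ D ×ˢ D, |wedge (z - x) q.2 / wedge q.1 q.2| < r ∧
        |wedge q.1 (z - x) / wedge q.1 q.2| < r := by
      rw [Filter.eventually_all_finset]
      intro q _
      have c1 : Continuous fun z : Plane => |wedge (z - x) q.2 / wedge q.1 q.2| := by
        unfold wedge; fun_prop
      have c2 : Continuous fun z : Plane => |wedge q.1 (z - x) / wedge q.1 q.2| := by
        unfold wedge; fun_prop
      refine ((c1.tendsto x).eventually_lt_const ?_).and ((c2.tendsto x).eventually_lt_const ?_)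
      · simpa [wedge] using hr0
      · simpa [wedge] using hr0
    exact this
  refine ⟨N, hNx, (fun q : Plane × Plane => parallelogram x q.1 q.2 r) ''
    {q | q ∈ D ×ˢ D ∧ wedge q.1 q.2 ≠ 0 ∧ parallelogram x q.1 q.2 r ⊆ Ω}, ?_, ?_, ?_⟩
  · exact ((D ×ˢ D).finite_toSet.subset fun q hq => hq.1).image _
  · rintro _ ⟨q, hq, rfl⟩
    exact ⟨q.1, q.2, r, hr0, hq.2.1, rfl, hq.2.2⟩
  refine measure_mono_null (t := ⋃ w ∈ D, (affineSpan ℝ {x, x + w} : Set Plane)) ?_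
    ((measure_biUnion_null_iff D.countable_toSet).2 fun w _ => volume_line_eq_zero _ _)
  rintro z ⟨⟨hzΩ, hzN⟩, hzB⟩
  by_contra hline
  have hray : ∀ w ∈ D, ∀ k : ℝ, z - x ≠ k • w := by
    intro w hw k he
    refine hline (Set.mem_biUnion hw ?_)
    have : z = AffineMap.lineMap x (x + w) k := by
      rw [AffineMap.lineMap_apply, vsub_eq_sub, add_sub_cancel_left, ← he]
      simp
    rw [this]
    exact AffineMap.lineMap_mem_affineSpan_pair k _ _
  have hDe : ∀ w ∈ ({!₂[1, 0], !₂[-1, 0], !₂[0, 1], !₂[0, -1]} : Finset Plane), w ∈ D := fun w hw =>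
    Finset.mem_union_right _ hw
  have hstart : ∃ u ∈ D, ∃ v ∈ D, wedge u v ≠ 0 ∧ z - x ∈ openCone u v := by
    set h := z - x with hh
    have h0 : h 0 ≠ 0 := fun h0 => hray !₂[0, 1] (hDe _ (by simp)) (h 1) (by
      ext i; fin_cases i <;> simp [h0])
    have h1 : h 1 ≠ 0 := fun h1 => hray !₂[1, 0] (hDe _ (by simp)) (h 0) (by
      ext i; fin_cases i <;> simp [h1])
    obtain ⟨a, ha, s, hs, hs'⟩ : ∃ a : ℝ, (a = 1 ∨ a = -1) ∧ ∃ s > 0, h 0 = s * a := by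
      rcases h0.lt_or_gt with h2 | h2
      · exact ⟨-1, Or.inr rfl, -h 0, by linarith, by ring⟩
      · exact ⟨1, Or.inl rfl, h 0, h2, by ring⟩
    obtain ⟨b, hb, t, ht, ht'⟩ : ∃ a : ℝ, (a = 1 ∨ a = -1) ∧ ∃ s > 0, h 1 = s * a := by
      rcases h1.lt_or_gt with h2 | h2
      · exact ⟨-1, Or.inr rfl, -h 1, by linarith, by ring⟩
      · exact ⟨1, Or.inl rfl, h 1, h2, by ring⟩
    refine ⟨!₂[a, 0], hDe _ ?_, !₂[0, b], hDe _ ?_, ?_, s, t, hs, ht, ?_⟩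
    · rcases ha with rfl | rfl <;> simp
    · rcases hb with rfl | rfl <;> simp
    · rcases ha with rfl | rfl <;> rcases hb with rfl | rfl <;> simp [wedge]
    · ext i
      fin_cases i <;> simp [hs', ht']
  obtain ⟨u, hu, v, hv, hne, ⟨s, t, hs, ht, hst⟩, hmin⟩ := exists_minimal_openCone D hray hstart
  have hzP : z ∈ parallelogram x u v r := by
    have hb := hzN (u, v) (Finset.mk_mem_product hu hv)
    dsimp only at hb
    have h1 := wedgeEquiv_smul_add_smul u v hne s t
    rw [← hst, wedgeEquiv_apply, Prod.mk.injEq] at h1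
    rw [h1.1, h1.2] at hb
    refine ⟨s, t, hs, (le_abs_self s).trans_lt hb.1, ht, (le_abs_self t).trans_lt hb.2, ?_⟩
    rw [← hst]
    abel
  have hPΩ : parallelogram x u v r ⊆ Ω := by
    refine (convex_parallelogram x u v r).isPreconnected.subset_of_disjoint_frontier hΩ
      ⟨z, hzP, hzΩ⟩ (Set.disjoint_left.2 fun p hp hpf => ?_)
    have hpb := hPball u hu v hv hp
    obtain ⟨s', t', hs', -, ht', -, rfl⟩ := hp
    rcases hδS _ hpb hpf with h | ⟨w, hw, k, hk, h⟩
    · have h1 := wedgeEquiv_smul_add_smul u v hne s' t'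
      rw [add_eq_left.1 h, map_zero] at h1
      exact hs'.ne (congrArg Prod.fst h1)
    · refine hmin w hw ⟨s' / k, t' / k, by positivity, by positivity, ?_⟩
      have h2 : s' • u + t' • v = k • w := add_left_cancel h
      rw [div_eq_inv_mul, div_eq_inv_mul, ← smul_smul, ← smul_smul, ← smul_add, h2,
        inv_smul_smul₀ hk.ne']
  exact hzB ⟨_, ⟨(u, v), ⟨Finset.mk_mem_product hu hv, hne, hPΩ⟩, rfl⟩, hzP⟩

/-- A polygonal domain satisfies the Sobolev-Poincaré inequality. -/
theorem IsPolygonalDomain.sobolevPoincare {Ω : Set Plane} (h : IsPolygonalDomain Ω) :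
    SobolevPoincare Ω Ω := by
  obtain ⟨S, hS⟩ := h.polygonal
  choose N hN ℬ hfin hℬ hnull using exists_local_parallelogram_cover S hS h.isOpen
  have hcomp : IsCompact (closure Ω) := h.isBounded.isCompact_closure
  obtain ⟨A, -, hA⟩ := hcomp.elim_nhds_subcover N fun x _ => hN x
  refine sobolevPoincare_of_ae_cover h.isOpen h.isConnected h.isBounded (ℬ := ⋃ x ∈ A, ℬ x)
    (A.finite_toSet.biUnion fun x _ => hfin x) ?_ ?_
  · intro B hB
    simp only [Set.mem_iUnion] at hB
    obtain ⟨x, -, hB⟩ := hB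
    obtain ⟨u, v, r, hr, hne, rfl, hsub⟩ := hℬ x B hB
    exact ⟨isOpen_parallelogram hne, hsub, sobolevPoincare_parallelogram h.isOpen hr hne hsub⟩
  · refine measure_mono_null (t := ⋃ x ∈ A, (Ω ∩ N x) \ ⋃₀ ℬ x) ?_
      ((measure_biUnion_null_iff A.countable_toSet).2 fun x _ => hnull x)
    rintro z ⟨hz, hzB⟩
    obtain ⟨x, hx, hzx⟩ := Set.mem_iUnion₂.1 (hA (subset_closure hz))
    refine Set.mem_iUnion₂.2 ⟨x, hx, ⟨hz, hzx⟩, ?_⟩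
    rintro ⟨B, hB, hzB'⟩
    exact hzB ⟨B, Set.mem_biUnion hx hB, hzB'⟩

/-! ### The triangles over the interior edges of a control volume -/

theorem abs_wedge_le (u v : Plane) : |wedge u v| ≤ ‖u‖ * ‖v‖ := by
  apply abs_le_of_sq_le_sq _ (by positivity)
  rw [mul_pow, EuclideanSpace.norm_sq_eq, EuclideanSpace.norm_sq_eq]
  simp only [Fin.sum_univ_two, Real.norm_eq_abs, sq_abs, wedge]
  nlinarith [sq_nonneg (u 0 * v 0 + u 1 * v 1)]

namespace PolygonalMesh

variable {Ω : Set Plane} {T Eint Eext : Type*}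

theorem side_eq_wedge (e : Plane × Plane) (x : Plane) :
    side e x = wedge (e.1 - x) (e.2 - x) := by
  simp only [side, wedge, PiLp.sub_apply]
  ring

theorem side_add_smul {e : Plane × Plane} {y : Plane} (hy : side e y = 0) (x : Plane) (t : ℝ) :
    side e (y + t • (x - y)) = t * side e x := by
  have : y + t • (x - y) = t • x + (1 - t) • y := by module
  rw [this, side_combo _ _ _ (by ring), hy]
  ring

theorem halfDisc_subset_of_pos {e : Plane × Plane} {z : Plane} {ρ s s' : ℝ} (h : 0 < s * s') :
    halfDisc e z ρ s ⊆ halfDisc e z ρ s' := by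
  rintro p ⟨hp, hs⟩
  refine ⟨hp, ?_⟩
  have h1 : 0 < (s * s') * (s * side e p) := mul_pos h hs
  have h2 : 0 < s ^ 2 * (s' * side e p) := by nlinarith
  exact pos_of_mul_pos_right h2 (sq_nonneg s)

theorem eventually_add_smul_mem_ball (x y : Plane) {ρ : ℝ} (hρ : 0 < ρ) :
    ∀ᶠ t in nhds (0 : ℝ), y + t • (x - y) ∈ Metric.ball y ρ := by
  have : Continuous fun t : ℝ => y + t • (x - y) := by fun_prop
  refine this.continuousAt.preimage_mem_nhds ?_
  simpa using Metric.ball_mem_nhds y hρ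

/-- At a point of one of its edges that is no vertex, a control volume contains the half disc on
the side of its centre: otherwise it would contain the opposite half disc, hence, being star-shaped,
the edge point itself. -/
theorem exists_halfDisc_center_subset [Finite Eint] (M : PolygonalMesh Ω T Eint Eext)
    (hΩ : IsOpen Ω) {σ : Eint} {K : T} (hσ : M.left σ = K ∨ M.right σ = K) {y : Plane}
    (hy : y ∈ edgeSet (M.intEdge σ)) (hv : y ∉ M.vertices)
    (hside : side (M.intEdge σ) (M.center K) ≠ 0) :
    ∃ ρ > 0, halfDisc (M.intEdge σ) y ρ (side (M.intEdge σ) (M.center K)) ⊆ M.cell K := by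
  set x := M.center K
  set s := side (M.intEdge σ) x with hs
  have hy0 := side_eq_zero_of_mem_edgeSet hy
  obtain ⟨ρ, hρ, h⟩ := M.exists_halfDisc_subset hΩ hv hy
  refine ⟨ρ, hρ, ?_⟩
  have hwrong : ¬ halfDisc (M.intEdge σ) y ρ (-s) ⊆ M.cell K := by
    intro hsub
    obtain ⟨t, ht, ht0⟩ := (((eventually_add_smul_mem_ball x y hρ).filter_mono
      nhdsWithin_le_nhds).and (eventually_mem_nhdsWithin (a := (0 : ℝ)) (s := Set.Iio 0))).exists
    have ht0' : t < 0 := ht0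
    have hp : y + t • (x - y) ∈ M.cell K := hsub ⟨ht, by
      rw [side_add_smul hy0, ← hs]
      have : 0 < s ^ 2 := by positivity
      nlinarith⟩
    have hyK : y ∈ M.cell K := by
      refine (M.starConvex_cell K).segment_subset hp ?_
      rw [segment_eq_image']
      refine ⟨1 / (1 - t), ⟨by apply div_nonneg <;> linarith, ?_⟩, ?_⟩
      · rw [div_le_one (by linarith)]
        linarith
      · have h1 : y + t • (x - y) - x = (1 - t) • (y - x) := by module
        have h2 : (1 - t) ≠ 0 := by linarith
        dsimp only
        rw [h1, smul_smul, div_mul_cancel₀ _ h2]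
        module
    exact M.not_mem_cell_of_mem_edge hy K hyK
  rcases h K (M.edgeSet_subset_frontier hσ hy).1 with h1 | h1 <;> rcases hside.lt_or_gt with h2 | h2
  · exact absurd ((halfDisc_subset_of_pos (by linarith)).trans h1) hwrong
  · exact (halfDisc_subset_of_pos (by linarith)).trans h1
  · exact (halfDisc_subset_of_pos (by linarith)).trans h1
  · exact absurd ((halfDisc_subset_of_pos (by linarith)).trans h1) hwrong

/-- A control volume contains the segments that join its centre to the points of its interior edges,
vertices excepted. -/
theorem add_smul_mem_cell [Finite Eint] (M : PolygonalMesh Ω T Eint Eext)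
    (hΩ : IsOpen Ω) {σ : Eint} {K : T} (hσ : M.left σ = K ∨ M.right σ = K) {y : Plane}
    (hy : y ∈ edgeSet (M.intEdge σ)) (hv : y ∉ M.vertices)
    (hside : side (M.intEdge σ) (M.center K) ≠ 0) {τ : ℝ} (h0 : 0 ≤ τ) (h1 : τ < 1) :
    M.center K + τ • (y - M.center K) ∈ M.cell K := by
  obtain ⟨ρ, hρ, hsub⟩ := M.exists_halfDisc_center_subset hΩ hσ hy hv hside
  set x := M.center K
  have hy0 := side_eq_zero_of_mem_edgeSet hy
  obtain ⟨t, ht, ht0, ht1⟩ := (((eventually_add_smul_mem_ball x y hρ).filter_mono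
    nhdsWithin_le_nhds).and ((eventually_mem_nhdsWithin (a := (0 : ℝ)) (s := Set.Ioi 0)).and
      ((gt_mem_nhds (sub_pos.2 h1)).filter_mono nhdsWithin_le_nhds))).exists
  have ht0' : 0 < t := ht0
  have hp : y + t • (x - y) ∈ M.cell K := hsub ⟨ht, by
    rw [side_add_smul hy0]
    have : 0 < side (M.intEdge σ) x ^ 2 := by positivity
    nlinarith⟩
  refine (M.starConvex_cell K).segment_subset hp ?_
  rw [segment_eq_image']
  have h2 : 0 < 1 - t := by linarith
  refine ⟨τ / (1 - t), ⟨by positivity, ?_⟩, ?_⟩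
  · rw [div_le_one h2]
    linarith
  · have h1 : y + t • (x - y) - x = (1 - t) • (y - x) := by module
    dsimp only
    rw [h1, smul_smul, div_mul_cancel₀ _ h2.ne']

theorem exists_mem_edge_notMem_vertices [Finite Eint] (M : PolygonalMesh Ω T Eint Eext)
    (σ : Eint) : ∃ y ∈ edgeSet (M.intEdge σ), y ∉ M.vertices := by
  have hinf : (edgeSet (M.intEdge σ)).Infinite := by
    rw [edgeSet, segment_eq_image_lineMap]
    exact (Set.Icc_infinite one_pos).image
      (AffineMap.lineMap_injective ℝ (M.intEdge_nondegenerate σ)).injOn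
  obtain ⟨y, hy, hy'⟩ := hinf.exists_notMem_finite M.finite_vertices
  exact ⟨y, hy, hy'⟩

theorem intDist_pos (M : PolygonalMesh Ω T Eint Eext) (σ : Eint) : 0 < M.intDist σ :=
  dist_pos.2 fun h => M.left_ne_right σ (M.eq_of_mem_of_mem_closure (M.center_mem _)
    (h ▸ subset_closure (M.center_mem _)))

theorem edgeLength_pos (M : PolygonalMesh Ω T Eint Eext) (σ : Eint) :
    0 < edgeLength (M.intEdge σ) := by
  rw [edgeLength_eq_dist]
  exact dist_pos.2 (M.intEdge_nondegenerate σ)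

theorem edgeLength_mul_distToEdgeLine_le (e : Plane × Plane) (x : Plane) :
    edgeLength e * distToEdgeLine x e ≤ |side e x| := by
  rw [edgeLength_eq_dist, side_eq_wedge]
  exact dist_mul_distToEdgeLine_le x e

/-- On a regular mesh, the centres do not lie on the lines of the interior edges. -/
theorem IsRegular.side_ne_zero {M : PolygonalMesh Ω T Eint Eext} {ζ : ℝ} (h : M.IsRegular ζ)
    (hζ : 0 < ζ) {σ : Eint} {K : T} (hσ : M.left σ = K ∨ M.right σ = K) :
    side (M.intEdge σ) (M.center K) ≠ 0 := by
  intro h0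
  have h1 := edgeLength_mul_distToEdgeLine_le (M.intEdge σ) (M.center K)
  rw [h0, abs_zero] at h1
  have h2 := mul_pos (M.edgeLength_pos σ)
    ((mul_pos hζ (M.intDist_pos σ)).trans_le (h.1 σ K hσ))
  linarith

/-- The centres of two neighbours lie on opposite sides of the common edge, so the parameter of
regularity of a mesh with an interior edge is at most one. -/
theorem IsRegular.le_one [Finite Eint] {M : PolygonalMesh Ω T Eint Eext} {ζ : ℝ}
    (h : M.IsRegular ζ) (hζ : 0 < ζ) (hΩ : IsOpen Ω) (σ : Eint) : ζ ≤ 1 := by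
  obtain ⟨y, hy, hv⟩ := M.exists_mem_edge_notMem_vertices σ
  set e := M.intEdge σ with he
  set x := M.center (M.left σ) with hx
  set x' := M.center (M.right σ) with hx'
  have hl : side e x ≠ 0 := h.side_ne_zero hζ (Or.inl rfl)
  have hr : side e x' ≠ 0 := h.side_ne_zero hζ (Or.inr rfl)
  obtain ⟨ρ, hρ, h1⟩ := M.exists_halfDisc_center_subset hΩ (Or.inl rfl) hy hv hl
  obtain ⟨ρ', hρ', h2⟩ := M.exists_halfDisc_center_subset hΩ (Or.inr rfl) hy hv hr
  have hopp : side e x * side e x' ≤ 0 := by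
    by_contra! hpos
    obtain ⟨p, hp, hps⟩ := nonempty_halfDisc (M.intEdge_nondegenerate σ)
      (side_eq_zero_of_mem_edgeSet hy) (lt_min hρ hρ') hl
    have hps' := (halfDisc_subset_of_pos hpos ⟨hp, hps⟩ : p ∈ halfDisc e y (min ρ ρ') _)
    exact M.left_ne_right σ (M.eq_of_mem_of_mem_closure
      (h1 ⟨Metric.ball_subset_ball (min_le_left _ _) hp, hps⟩)
      (subset_closure (h2 ⟨Metric.ball_subset_ball (min_le_right _ _) hp, hps'.2⟩)))
  have hle : |side e x| ≤ |side e x - side e x'| := by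
    apply sq_le_sq.1
    nlinarith [sq_nonneg (side e x')]
  have hsub : side e x - side e x' = wedge (e.2 - e.1) (x - x') := by
    simp only [side, wedge, PiLp.sub_apply]
    ring
  have hm := edgeLength_mul_distToEdgeLine_le e x
  have hlen : ‖e.2 - e.1‖ = edgeLength e := by
    rw [edgeLength_eq_dist, dist_comm, dist_eq_norm]
  have hd : ‖x - x'‖ = M.intDist σ := by
    rw [← dist_eq_norm]
    rfl
  have hw := abs_wedge_le (e.2 - e.1) (x - x')
  rw [hlen, hd, ← hsub] at hw
  have h3 : distToEdgeLine x e ≤ M.intDist σ :=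
    le_of_mul_le_mul_left ((hm.trans hle).trans hw) (M.edgeLength_pos σ)
  have h4 := (h.1 σ _ (Or.inl rfl)).trans h3
  exact le_of_mul_le_mul_right (by linarith) (M.intDist_pos σ)

/-- The triangles with apex the centre over the interior edges of a control volume are contained in
it and do not overlap. Each of them is represented by a parallelogram of half its area. -/
theorem sum_edgeLength_mul_distToEdgeLine_le [Fintype Eint] [DecidableEq T]
    (M : PolygonalMesh Ω T Eint Eext) (hΩ : IsOpen Ω) (hb : Bornology.IsBounded Ω) (K : T)
    (hside : ∀ σ, M.left σ = K ∨ M.right σ = K → side (M.intEdge σ) (M.center K) ≠ 0) :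
    ∑ σ with M.left σ = K ∨ M.right σ = K,
      edgeLength (M.intEdge σ) * distToEdgeLine (M.center K) (M.intEdge σ) ≤ 4 * M.area K := by
  set x := M.center K with hx
  set A : Finset Eint := {σ | M.left σ = K ∨ M.right σ = K} with hA
  have hAmem : ∀ σ ∈ A, M.left σ = K ∨ M.right σ = K := fun σ hσ => (Finset.mem_filter.1 hσ).2
  set N : Set Plane := ⋃ p ∈ M.vertices, (affineSpan ℝ {x, p} : Set Plane) with hN
  have hN0 : volume N = 0 :=
    (measure_biUnion_null_iff M.finite_vertices.countable).2 fun p _ => volume_line_eq_zero _ _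
  set Q : Eint → Set Plane := fun σ =>
    parallelogram x ((M.intEdge σ).1 - x) ((M.intEdge σ).2 - x) (1 / 2) with hQ
  have hwedge : ∀ σ ∈ A, wedge ((M.intEdge σ).1 - x) ((M.intEdge σ).2 - x) ≠ 0 := fun σ hσ => by
    rw [← side_eq_wedge]
    exact hside σ (hAmem σ hσ)
  have hQray : ∀ σ, ∀ z ∈ Q σ \ N, ∃ y ∈ edgeSet (M.intEdge σ), y ∉ M.vertices ∧
      ∃ τ : ℝ, 0 < τ ∧ τ < 1 ∧ z = x + τ • (y - x) := by
    rintro σ z ⟨⟨s, t, hs, hs', ht, ht', rfl⟩, hzN⟩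
    have hst : 0 < s + t := by positivity
    set y : Plane := (s / (s + t)) • (M.intEdge σ).1 + (t / (s + t)) • (M.intEdge σ).2 with hy
    have hz : x + (s • ((M.intEdge σ).1 - x) + t • ((M.intEdge σ).2 - x))
        = x + (s + t) • (y - x) := by
      have h1 : (s + t) • y = s • (M.intEdge σ).1 + t • (M.intEdge σ).2 := by
        rw [hy, smul_add, smul_smul, smul_smul, mul_div_cancel₀ _ hst.ne',
          mul_div_cancel₀ _ hst.ne']
      rw [smul_sub (s + t), h1]
      module
    refine ⟨y, ⟨_, _, by positivity, by positivity, by rw [← add_div, div_self hst.ne'], rfl⟩, ?_,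
      s + t, hst, by linarith, hz⟩
    intro hyv
    refine hzN (Set.mem_biUnion hyv ?_)
    rw [hz]
    have : x + (s + t) • (y - x) = AffineMap.lineMap x y (s + t) := by
      rw [AffineMap.lineMap_apply, vsub_eq_sub, vadd_eq_add, add_comm]
    rw [this]
    exact AffineMap.lineMap_mem_affineSpan_pair _ _ _
  have hQK : ∀ σ ∈ A, Q σ \ N ⊆ M.cell K := by
    intro σ hσ z hz
    obtain ⟨y, hy, hyv, τ, h0, h1, rfl⟩ := hQray σ z hz
    exact M.add_smul_mem_cell hΩ (hAmem σ hσ) hy hyv (hside σ (hAmem σ hσ)) h0.le h1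
  -- of two edge points on a ray from the centre, the nearer one would lie in the control volume
  have hfar : ∀ σ ∈ A, ∀ σ', ∀ y ∈ edgeSet (M.intEdge σ), y ∉ M.vertices →
      ∀ y' ∈ edgeSet (M.intEdge σ'), ∀ τ τ' : ℝ, 0 < τ → 0 < τ' →
      x + τ • (y - x) = x + τ' • (y' - x) → ¬ τ < τ' := by
    intro σ hσ σ' y hy hyv y' hy' τ τ' h0 h0' heq hlt
    refine M.not_mem_cell_of_mem_edge hy' K ?_
    have h1 : y' = x + (τ / τ') • (y - x) := by
      have h2 := add_left_cancel heq
      rw [div_eq_inv_mul, ← smul_smul, h2, inv_smul_smul₀ h0'.ne']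
      abel
    rw [h1]
    exact M.add_smul_mem_cell hΩ (hAmem σ hσ) hy hyv (hside σ (hAmem σ hσ)) (by positivity)
      ((div_lt_one h0').2 hlt)
  have hdisj : (A : Set Eint).PairwiseDisjoint fun σ => Q σ \ N := by
    intro σ hσ σ' hσ' hne
    refine Set.disjoint_left.2 fun z hz hz' => ?_
    obtain ⟨y, hy, hyv, τ, h0, -, rfl⟩ := hQray σ z hz
    obtain ⟨y', hy', hyv', τ', h0', -, heq⟩ := hQray σ' _ hz'
    rcases lt_trichotomy τ τ' with h | h | h
    · exact hfar σ hσ σ' y hy hyv y' hy' τ τ' h0 h0' heq h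
    · subst h
      have h1 : y = y' := by
        have h2 := smul_right_injective Plane h0.ne' (add_left_cancel heq)
        exact sub_left_injective h2
      subst h1
      exact Set.disjoint_left.1 (M.disjoint_intEdge σ σ' hne) (M.mem_edgeInterior hyv hy)
        (M.mem_edgeInterior hyv hy')
    · exact hfar σ' hσ' σ y' hy' hyv' y hy τ' τ h0' h0 heq.symm h
  have hNm : MeasurableSet N := M.finite_vertices.measurableSet_biUnion fun p _ =>
    (AffineSubspace.closed_of_finiteDimensional _).measurableSet
  have hfin : volume (M.cell K) ≠ ⊤ := (hb.subset (M.cell_subset K)).measure_lt_top.ne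
  have hvol : ∑ σ ∈ A, ENNReal.ofReal ((1 / 2) ^ 2 * |side (M.intEdge σ) x|)
      ≤ volume (M.cell K) := by
    calc ∑ σ ∈ A, ENNReal.ofReal ((1 / 2) ^ 2 * |side (M.intEdge σ) x|)
        = ∑ σ ∈ A, volume (Q σ \ N) := by
          refine Finset.sum_congr rfl fun σ _ => ?_
          rw [measure_sdiff_null hN0, hQ]
          dsimp only
          rw [volume_parallelogram _ _ _ _ (by norm_num), side_eq_wedge]
      _ = volume (⋃ σ ∈ A, Q σ \ N) :=
          (measure_biUnion_finset hdisj fun σ hσ =>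
            (isOpen_parallelogram (hwedge σ hσ)).measurableSet.diff hNm).symm
      _ ≤ volume (M.cell K) := measure_mono (Set.iUnion₂_subset hQK)
  rw [← ENNReal.ofReal_sum_of_nonneg fun σ _ => by positivity] at hvol
  have h1 := (ENNReal.ofReal_le_iff_le_toReal hfin).1 hvol
  rw [← Finset.mul_sum] at h1
  have h2 : ∑ σ ∈ A, edgeLength (M.intEdge σ) * distToEdgeLine x (M.intEdge σ)
      ≤ ∑ σ ∈ A, |side (M.intEdge σ) x| :=
    Finset.sum_le_sum fun σ _ => edgeLength_mul_distToEdgeLine_le _ _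
  change _ ≤ 4 * (volume (M.cell K)).toReal
  linarith

/-- The diamonds spanned by an interior edge and the two adjacent centres have bounded overlap: a
weighted sum of `m_σ d_σ` over the edges is controlled by the weighted sum of the areas. -/
theorem IsRegular.sum_edgeLength_mul_intDist_le [Fintype T] [Fintype Eint]
    {M : PolygonalMesh Ω T Eint Eext} {ζ : ℝ} (h : M.IsRegular ζ) (hζ : 0 < ζ) (hΩ : IsOpen Ω)
    (hb : Bornology.IsBounded Ω) {g : T → ℝ} (hg : ∀ K, 0 ≤ g K) :
    ∑ σ, edgeLength (M.intEdge σ) * M.intDist σ * (g (M.left σ) + g (M.right σ))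
      ≤ 4 / ζ * ∑ K, M.area K * g K := by
  classical
  set G : T → Eint → ℝ := fun K σ =>
    edgeLength (M.intEdge σ) * distToEdgeLine (M.center K) (M.intEdge σ) * g K with hG
  have hterm : ∀ σ K, (M.left σ = K ∨ M.right σ = K) →
      edgeLength (M.intEdge σ) * M.intDist σ * g K ≤ 1 / ζ * G K σ := by
    intro σ K hσ
    have h1 : M.intDist σ ≤ 1 / ζ * distToEdgeLine (M.center K) (M.intEdge σ) := by
      rw [one_div_mul_eq_div, le_div_iff₀ hζ, mul_comm]
      exact h.1 σ K hσ
    have h2 := mul_le_mul_of_nonneg_right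
      (mul_le_mul_of_nonneg_left h1 (edgeLength_nonneg (M.intEdge σ))) (hg K)
    calc _ ≤ _ := h2
      _ = _ := by rw [hG]; ring
  have hswap : ∑ σ, (G (M.left σ) σ + G (M.right σ) σ)
      = ∑ K, ∑ σ with M.left σ = K ∨ M.right σ = K, G K σ := by
    simp_rw [Finset.sum_filter]
    rw [Finset.sum_comm]
    refine Finset.sum_congr rfl fun σ _ => ?_
    rw [← Finset.sum_filter]
    have : (Finset.univ.filter fun K => M.left σ = K ∨ M.right σ = K)
        = {M.left σ, M.right σ} := by
      ext K
      simp [eq_comm]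
    rw [this, Finset.sum_pair (M.left_ne_right σ)]
  calc ∑ σ, edgeLength (M.intEdge σ) * M.intDist σ * (g (M.left σ) + g (M.right σ))
      ≤ ∑ σ, 1 / ζ * (G (M.left σ) σ + G (M.right σ) σ) := by
        refine Finset.sum_le_sum fun σ _ => ?_
        rw [mul_add, mul_add]
        exact add_le_add (hterm σ _ (Or.inl rfl)) (hterm σ _ (Or.inr rfl))
    _ = 1 / ζ * ∑ K, (∑ σ with M.left σ = K ∨ M.right σ = K, edgeLength (M.intEdge σ) *
          distToEdgeLine (M.center K) (M.intEdge σ)) * g K := by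
        rw [← Finset.mul_sum, hswap]
        simp_rw [Finset.sum_mul, hG]
    _ ≤ 1 / ζ * ∑ K, 4 * M.area K * g K := by
        gcongr with K _
        · exact hg K
        · exact M.sum_edgeLength_mul_distToEdgeLine_le hΩ hb K fun σ hσ => h.side_ne_zero hζ hσ
    _ = 4 / ζ * ∑ K, M.area K * g K := by
        simp_rw [mul_assoc]
        rw [← Finset.mul_sum]
        ring

end PolygonalMesh

/-! ### Inequalities for finite probability spaces -/

section FiniteProbability

variable {ι : Type*} [Fintype ι] {w : ι → ℝ}

theorem sum_mul_sq_sub_sum_le (hw1 : ∑ i, w i = 1) (f : ι → ℝ) (c : ℝ) :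
    ∑ i, w i * (f i - ∑ j, w j * f j) ^ 2 ≤ ∑ i, w i * (f i - c) ^ 2 := by
  set m := ∑ j, w j * f j with hm
  have h : ∀ a : ℝ, ∑ i, w i * (f i - a) ^ 2 = ∑ i, w i * f i ^ 2 - 2 * a * m + a ^ 2 := by
    intro a
    calc ∑ i, w i * (f i - a) ^ 2
        = ∑ i, (w i * f i ^ 2 - 2 * a * (w i * f i) + a ^ 2 * w i) :=
          Finset.sum_congr rfl fun i _ => by ring
      _ = _ := by
          rw [Finset.sum_add_distrib, Finset.sum_sub_distrib, ← Finset.mul_sum, ← Finset.mul_sum,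
            hw1, mul_one]
  rw [h, h]
  nlinarith [sq_nonneg (m - c)]

theorem sum_sub_sum_rpow_le (hw : ∀ i, 0 ≤ w i) (hw1 : ∑ i, w i = 1) {p : ℝ} (hp1 : 1 < p)
    (hp2 : p ≤ 2) {f : ι → ℝ} (hf : ∀ i, 0 ≤ f i) :
    ∑ i, w i * f i ^ 2 - (∑ i, w i * f i ^ (2 / p)) ^ p
      ≤ ∑ i, w i * (f i - ∑ j, w j * f j) ^ 2 := by
  set m := ∑ j, w j * f j with hm
  have hp0 : 0 < p := by linarith
  have hm0 : 0 ≤ m := Finset.sum_nonneg fun i _ => mul_nonneg (hw i) (hf i)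
  have hvar : ∑ i, w i * (f i - m) ^ 2 = ∑ i, w i * f i ^ 2 - m ^ 2 := by
    calc ∑ i, w i * (f i - m) ^ 2
        = ∑ i, (w i * f i ^ 2 - 2 * m * (w i * f i) + m ^ 2 * w i) :=
          Finset.sum_congr rfl fun i _ => by ring
      _ = _ := by
          rw [Finset.sum_add_distrib, Finset.sum_sub_distrib, ← Finset.mul_sum, ← Finset.mul_sum,
            hw1, ← hm]
          ring
  have hjensen : m ^ (2 / p) ≤ ∑ i, w i * f i ^ (2 / p) :=
    Real.rpow_arith_mean_le_arith_mean_rpow _ _ _ (fun i _ => hw i) hw1 (fun i _ => hf i)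
      (by rwa [one_le_div hp0])
  have h2 : m ^ 2 ≤ (∑ i, w i * f i ^ (2 / p)) ^ p := by
    calc m ^ 2 = (m ^ (2 / p)) ^ p := by
          rw [← Real.rpow_mul hm0, div_mul_cancel₀ _ hp0.ne']
          norm_num
      _ ≤ _ := Real.rpow_le_rpow (Real.rpow_nonneg hm0 _) hjensen hp0.le
  linarith

theorem sum_mul_pow_pos (hw : ∀ i, 0 ≤ w i) (hw1 : ∑ i, w i = 1) {f : ι → ℝ}
    (hf : ∀ i, 0 < f i) (n : ℕ) : 0 < ∑ i, w i * f i ^ n := by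
  obtain ⟨i, -, hi⟩ : ∃ i ∈ Finset.univ, 0 < w i := by
    apply Finset.exists_lt_of_sum_lt (f := fun _ => (0 : ℝ))
    rw [hw1]
    simp
  exact Finset.sum_pos' (fun j _ => mul_nonneg (hw j) (pow_pos (hf j) n).le)
    ⟨i, Finset.mem_univ i, mul_pos hi (pow_pos (hf i) n)⟩

/-- The entropy is bounded by the chi-square distance to any constant. -/
theorem entropy_le_sum_sq_div (hw : ∀ i, 0 ≤ w i) (hw1 : ∑ i, w i = 1) {f : ι → ℝ}
    (hf : ∀ i, 0 < f i) {b : ℝ} (hb : 0 < b) :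
    ∑ i, w i * (f i ^ 2 * Real.log (f i ^ 2 / ∑ j, w j * f j ^ 2))
      ≤ ∑ i, w i * ((f i ^ 2 - b) ^ 2 / b) := by
  set Z := ∑ j, w j * f j ^ 2 with hZ
  have hZ0 : 0 < Z := sum_mul_pow_pos hw hw1 hf 2
  have h1 : Z - b ≤ Z * Real.log (Z / b) := by
    have h := mul_le_mul_of_nonneg_left (Real.one_sub_inv_le_log_of_pos (div_pos hZ0 hb)) hZ0.le
    have e : Z * (1 - (Z / b)⁻¹) = Z - b := by field_simp
    linarith
  have h2 : ∀ i, f i ^ 2 * Real.log (f i ^ 2 / Z)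
      ≤ f i ^ 2 * ((f i ^ 2 - b) / b) - f i ^ 2 * Real.log (Z / b) := by
    intro i
    have hfi : 0 < f i ^ 2 := pow_pos (hf i) 2
    have e : Real.log (f i ^ 2 / Z) = Real.log (f i ^ 2 / b) - Real.log (Z / b) := by
      rw [Real.log_div hfi.ne' hZ0.ne', Real.log_div hfi.ne' hb.ne', Real.log_div hZ0.ne' hb.ne']
      ring
    have h := Real.log_le_sub_one_of_pos (div_pos hfi hb)
    have e' : f i ^ 2 / b - 1 = (f i ^ 2 - b) / b := by field_simp
    rw [e, mul_sub, ← e']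
    gcongr
  calc ∑ i, w i * (f i ^ 2 * Real.log (f i ^ 2 / Z))
      ≤ ∑ i, w i * (f i ^ 2 * ((f i ^ 2 - b) / b) - f i ^ 2 * Real.log (Z / b)) :=
        Finset.sum_le_sum fun i _ => mul_le_mul_of_nonneg_left (h2 i) (hw i)
    _ = ∑ i, w i * (f i ^ 2 * ((f i ^ 2 - b) / b)) - Z * Real.log (Z / b) := by
        simp_rw [mul_sub]
        rw [Finset.sum_sub_distrib, hZ, Finset.sum_mul]
        simp_rw [mul_assoc]
    _ ≤ ∑ i, w i * (f i ^ 2 * ((f i ^ 2 - b) / b)) - (Z - b * ∑ i, w i) := by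
        rw [hw1]
        linarith
    _ = ∑ i, w i * ((f i ^ 2 - b) ^ 2 / b) := by
        rw [hZ, Finset.mul_sum, ← Finset.sum_sub_distrib, ← Finset.sum_sub_distrib]
        refine Finset.sum_congr rfl fun i _ => ?_
        field_simp

/-- The entropy of `f ^ 2` is bounded by the squared `L⁴` distance of `f` to any constant. -/
theorem entropy_le_sqrt_sum_pow_four (hw : ∀ i, 0 ≤ w i) (hw1 : ∑ i, w i = 1) {f : ι → ℝ}
    (hf : ∀ i, 0 < f i) (a : ℝ) :
    ∑ i, w i * (f i ^ 2 * Real.log (f i ^ 2 / ∑ j, w j * f j ^ 2))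
      ≤ 10 * √(∑ i, w i * (f i - a) ^ 4) := by
  set A := ∑ i, w i * (f i - a) ^ 4 with hA
  have hA0 : 0 ≤ A := Finset.sum_nonneg fun i _ => mul_nonneg (hw i) (by positivity)
  have hsA : √A ^ 2 = A := Real.sq_sqrt hA0
  by_cases ha : 0 < a ∧ √A < a ^ 2
  · -- the constant is large compared with the fluctuations
    obtain ⟨ha0, haA⟩ := ha
    have hvar : ∑ i, w i * (f i - a) ^ 2 ≤ √A := by
      apply Real.le_sqrt_of_sq_le
      set m := ∑ i, w i * (f i - a) ^ 2 with hm
      have h : 0 ≤ ∑ i, w i * ((f i - a) ^ 2 - m) ^ 2 :=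
        Finset.sum_nonneg fun i _ => mul_nonneg (hw i) (sq_nonneg _)
      have e : ∑ i, w i * ((f i - a) ^ 2 - m) ^ 2 = A - m ^ 2 := by
        calc ∑ i, w i * ((f i - a) ^ 2 - m) ^ 2
            = ∑ i, (w i * (f i - a) ^ 4 - 2 * m * (w i * (f i - a) ^ 2) + m ^ 2 * w i) :=
              Finset.sum_congr rfl fun i _ => by ring
          _ = _ := by
              rw [Finset.sum_add_distrib, Finset.sum_sub_distrib, ← Finset.mul_sum,
                ← Finset.mul_sum, hw1, ← hm]
              ring
      linarith
    have ha2 : 0 < a ^ 2 := by positivity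
    refine (entropy_le_sum_sq_div hw hw1 hf ha2).trans ?_
    calc ∑ i, w i * ((f i ^ 2 - a ^ 2) ^ 2 / a ^ 2)
        ≤ ∑ i, (2 / a ^ 2 * (w i * (f i - a) ^ 4) + 8 * (w i * (f i - a) ^ 2)) := by
          refine Finset.sum_le_sum fun i _ => ?_
          have h : (f i ^ 2 - a ^ 2) ^ 2 / a ^ 2
              ≤ 2 / a ^ 2 * (f i - a) ^ 4 + 8 * (f i - a) ^ 2 := by
            rw [div_le_iff₀ ha2]
            have e : (2 / a ^ 2 * (f i - a) ^ 4 + 8 * (f i - a) ^ 2) * a ^ 2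
                = (f i - a) ^ 2 * (2 * (f i - a) ^ 2 + 8 * a ^ 2) := by
              field_simp
            have e' : (f i ^ 2 - a ^ 2) ^ 2 = (f i - a) ^ 2 * (f i + a) ^ 2 := by ring
            rw [e, e']
            refine mul_le_mul_of_nonneg_left ?_ (sq_nonneg _)
            nlinarith [sq_nonneg (f i - 3 * a)]
          calc _ ≤ w i * (2 / a ^ 2 * (f i - a) ^ 4 + 8 * (f i - a) ^ 2) :=
                mul_le_mul_of_nonneg_left h (hw i)
            _ = _ := by ring
      _ = 2 / a ^ 2 * A + 8 * ∑ i, w i * (f i - a) ^ 2 := by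
          rw [Finset.sum_add_distrib, ← Finset.mul_sum, ← Finset.mul_sum]
      _ ≤ 2 * √A + 8 * √A := by
          refine add_le_add ?_ (mul_le_mul_of_nonneg_left hvar (by norm_num))
          rw [div_mul_eq_mul_div, div_le_iff₀ ha2, mul_assoc]
          nlinarith [mul_le_mul_of_nonneg_left haA.le (Real.sqrt_nonneg A)]
      _ = 10 * √A := by ring
  · -- the fluctuations dominate: compare with the constant `√(∑ w f ^ 4)`
    set B := ∑ i, w i * f i ^ 4 with hB
    have hB0 : 0 < B := sum_mul_pow_pos hw hw1 hf 4
    have hBA : B ≤ 16 * A := by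
      rcases le_or_gt a 0 with h | h
      · have h1 : B ≤ A := Finset.sum_le_sum fun i _ => mul_le_mul_of_nonneg_left
          (pow_le_pow_left₀ (hf i).le (by linarith) 4) (hw i)
        linarith
      · have h1 : a ^ 2 ≤ √A := not_lt.1 fun h2 => ha ⟨h, h2⟩
        have h2 : a ^ 4 ≤ A := by
          calc a ^ 4 = (a ^ 2) ^ 2 := by ring
            _ ≤ √A ^ 2 := pow_le_pow_left₀ (sq_nonneg a) h1 2
            _ = A := hsA
        calc B ≤ ∑ i, (8 * (w i * (f i - a) ^ 4) + 8 * a ^ 4 * w i) := by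
              refine Finset.sum_le_sum fun i _ => ?_
              have h3 : f i ^ 4 ≤ 8 * (f i - a) ^ 4 + 8 * a ^ 4 := by
                have h4 : f i ^ 2 ≤ 2 * (f i - a) ^ 2 + 2 * a ^ 2 := by
                  nlinarith [sq_nonneg (f i - 2 * a)]
                have h5 : (f i ^ 2) ^ 2 ≤ (2 * (f i - a) ^ 2 + 2 * a ^ 2) ^ 2 :=
                  pow_le_pow_left₀ (sq_nonneg _) h4 2
                nlinarith [sq_nonneg ((f i - a) ^ 2 - a ^ 2)]
              calc _ ≤ w i * (8 * (f i - a) ^ 4 + 8 * a ^ 4) :=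
                    mul_le_mul_of_nonneg_left h3 (hw i)
                _ = _ := by ring
          _ = 8 * A + 8 * a ^ 4 := by
              rw [Finset.sum_add_distrib, ← Finset.mul_sum, ← Finset.mul_sum, hw1, mul_one]
          _ ≤ 16 * A := by linarith
    have hsB : √B ≤ 4 * √A := by
      rw [show (4 : ℝ) = √16 by rw [show (16 : ℝ) = 4 ^ 2 by norm_num]; simp, ← Real.sqrt_mul
        (by norm_num)]
      exact Real.sqrt_le_sqrt hBA
    have hb : 0 < √B := Real.sqrt_pos.2 hB0
    have hsB2 : √B ^ 2 = B := Real.sq_sqrt hB0.le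
    refine (entropy_le_sum_sq_div hw hw1 hf hb).trans ?_
    have hZ0 := sum_mul_pow_pos hw hw1 hf 2
    have e : ∑ i, w i * ((f i ^ 2 - √B) ^ 2 / √B)
        = B / √B - 2 * ∑ i, w i * f i ^ 2 + √B := by
      calc ∑ i, w i * ((f i ^ 2 - √B) ^ 2 / √B)
          = ∑ i, (w i * f i ^ 4 / √B - 2 * (w i * f i ^ 2) + √B * w i) :=
            Finset.sum_congr rfl fun i _ => by field_simp; ring
        _ = _ := by
            rw [Finset.sum_add_distrib, Finset.sum_sub_distrib, ← Finset.mul_sum, ← Finset.mul_sum,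
              ← Finset.sum_div, hw1, mul_one]
    rw [e, Real.div_sqrt]
    have := Real.sqrt_nonneg A
    linarith

end FiniteProbability

/-! ### The discrete functional inequalities -/

namespace PolygonalMesh

variable {Ω : Set Plane} {T Eint Eext : Type*}

theorem energy_nonneg [Fintype Eint] (M : PolygonalMesh Ω T Eint Eext) (f : T → ℝ) :
    0 ≤ M.energy f :=
  Finset.sum_nonneg fun _ _ =>
    mul_nonneg (div_nonneg (edgeLength_nonneg _) dist_nonneg) (sq_nonneg _)

/-- The Cauchy-Schwarz inequality between total variation and energy. -/
theorem sum_edgeLength_mul_jump_sq_le [Fintype Eint] (M : PolygonalMesh Ω T Eint Eext)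
    (f : T → ℝ) (k : Eint → ℝ) :
    (∑ σ, edgeLength (M.intEdge σ) * (M.jump f σ * k σ)) ^ 2
      ≤ M.energy f * ∑ σ, edgeLength (M.intEdge σ) * M.intDist σ * k σ ^ 2 := by
  refine Finset.sum_sq_le_sum_mul_sum_of_sq_le_mul _ (fun _ _ => ?_) (fun _ _ => ?_)
    (fun σ _ => le_of_eq ?_)
  · exact mul_nonneg (div_nonneg (edgeLength_nonneg _) dist_nonneg) (sq_nonneg _)
  · exact mul_nonneg (mul_nonneg (edgeLength_nonneg _) dist_nonneg) (sq_nonneg _)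
  · have := (M.intDist_pos σ).ne'
    rw [trans, jump]
    field_simp

theorem sum_area [Fintype T] [Finite Eint] (M : PolygonalMesh Ω T Eint Eext)
    (hΩ : IsOpen Ω) (hb : Bornology.IsBounded Ω) : ∑ K, M.area K = (volume Ω).toReal := by
  rw [← M.sum_volume_cell_inter hΩ hb hΩ.measurableSet subset_rfl]
  exact Finset.sum_congr rfl fun K _ => by
    rw [area, Set.inter_eq_left.2 (M.cell_subset K)]

theorem area_nonneg (M : PolygonalMesh Ω T Eint Eext) (K : T) : 0 ≤ M.area K :=
  ENNReal.toReal_nonneg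

theorem IsRegular.variation_sq_le [Fintype T] [Fintype Eint]
    {M : PolygonalMesh Ω T Eint Eext} {ζ : ℝ} (h : M.IsRegular ζ) (hζ : 0 < ζ) (hΩ : IsOpen Ω)
    (hb : Bornology.IsBounded Ω) (f : T → ℝ) :
    M.variation f ^ 2 ≤ 2 * (volume Ω).toReal * (M.energy f / ζ) := by
  have h1 := M.sum_edgeLength_mul_jump_sq_le f fun _ => 1
  have h2 := h.sum_edgeLength_mul_intDist_le hζ hΩ hb (g := fun _ => 1 / 2) fun _ => by norm_num
  rw [← Finset.sum_mul, ← Finset.sum_mul, M.sum_area hΩ hb] at h2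
  simp only [mul_one, one_pow] at h1
  change M.variation f ^ 2 ≤ _ at h1
  calc M.variation f ^ 2 ≤ _ := h1
    _ ≤ M.energy f * (4 / ζ * ((volume Ω).toReal * (1 / 2))) :=
        mul_le_mul_of_nonneg_left (by linarith) (M.energy_nonneg f)
    _ = _ := by ring

/-- The variation of `g ^ 2`, where `g = f - c`, in terms of the energy of `f` and of the `L²` norm
of `g`. -/
theorem IsRegular.variation_sq_sub_le [Fintype T] [Fintype Eint]
    {M : PolygonalMesh Ω T Eint Eext} {ζ : ℝ} (h : M.IsRegular ζ) (hζ : 0 < ζ) (hΩ : IsOpen Ω)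
    (hb : Bornology.IsBounded Ω) (f : T → ℝ) (c : ℝ) :
    M.variation (fun K => (f K - c) ^ 2) ^ 2
      ≤ 8 * (M.energy f / ζ) * ∑ K, M.area K * (f K - c) ^ 2 := by
  set k : Eint → ℝ := fun σ => |f (M.left σ) - c + (f (M.right σ) - c)| with hk
  have h1 := M.sum_edgeLength_mul_jump_sq_le f k
  have h2 := h.sum_edgeLength_mul_intDist_le hζ hΩ hb
    (g := fun K => 2 * (f K - c) ^ 2) fun _ => by positivity
  have e : M.variation (fun K => (f K - c) ^ 2)
      = ∑ σ, edgeLength (M.intEdge σ) * (M.jump f σ * k σ) := by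
    refine Finset.sum_congr rfl fun σ _ => ?_
    rw [jump, jump, hk, ← abs_mul]
    congr 2
    ring
  have h3 : ∑ σ, edgeLength (M.intEdge σ) * M.intDist σ * k σ ^ 2
      ≤ ∑ σ, edgeLength (M.intEdge σ) * M.intDist σ *
        (2 * (f (M.left σ) - c) ^ 2 + 2 * (f (M.right σ) - c) ^ 2) := by
    refine Finset.sum_le_sum fun σ _ => mul_le_mul_of_nonneg_left ?_
      (mul_nonneg (edgeLength_nonneg _) (M.intDist_pos σ).le)
    rw [hk, sq_abs]
    nlinarith [sq_nonneg (f (M.left σ) - c - (f (M.right σ) - c))]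
  rw [e]
  calc _ ≤ _ := h1
    _ ≤ M.energy f * (4 / ζ * ∑ K, M.area K * (2 * (f K - c) ^ 2)) :=
        mul_le_mul_of_nonneg_left (h3.trans h2) (M.energy_nonneg f)
    _ = _ := by
        rw [show ∑ K, M.area K * (2 * (f K - c) ^ 2) = 2 * ∑ K, M.area K * (f K - c) ^ 2 by
          rw [Finset.mul_sum]; exact Finset.sum_congr rfl fun K _ => by ring]
        ring

end PolygonalMesh

/-- The discrete functional inequalities for the Lebesgue measure: a constant `c` such that the `L²`
and the `L⁴` norm of `f - c` are controlled by the energy. The `L⁴` bound is the Sobolev-Poincaré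
inequality for `(f - c) ^ 2`. -/
theorem IsPolygonalDomain.exists_sum_area_le {Ω : Set Plane} (hΩ : IsPolygonalDomain Ω) :
    ∃ C₂ C₄ : ℝ, 0 ≤ C₂ ∧ 0 ≤ C₄ ∧ ∀ (T Eint Eext : Type) [Fintype T] [Fintype Eint] [Fintype Eext]
      (M : PolygonalMesh Ω T Eint Eext) (ζ : ℝ), 0 < ζ → M.IsRegular ζ → ∀ f : T → ℝ, ∃ c : ℝ,
        ∑ K, M.area K * (f K - c) ^ 2 ≤ C₂ * (M.energy f / ζ) ∧
        ∑ K, M.area K * (f K - c) ^ 4 ≤ C₄ * (M.energy f / ζ) ^ 2 := by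
  obtain ⟨C₀, hC₀, hSP⟩ := hΩ.sobolevPoincare
  set m : ℝ := (volume Ω).toReal with hm
  have hm0 : 0 < m := ENNReal.toReal_pos (hΩ.isOpen.measure_pos _ hΩ.isConnected.nonempty).ne'
    hΩ.isBounded.measure_lt_top.ne
  set C₂ := C₀ * (2 * m) with hC₂
  have hC₂0 : 0 ≤ C₂ := by positivity
  refine ⟨C₂, C₀ * 8 * C₂ + C₂ ^ 2 / m, hC₂0, by positivity, ?_⟩
  intro T Eint Eext _ _ _ M ζ hζ hreg f
  have hcell : ∀ K, (volume (M.cell K ∩ Ω)).toReal = M.area K := fun K => by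
    rw [Set.inter_eq_left.2 (M.cell_subset K)]
    rfl
  have hSP' : ∀ g : T → ℝ, ∃ c, ∑ K, M.area K * (g K - c) ^ 2 ≤ C₀ * M.variation g ^ 2 :=
      fun g => by
    simpa only [hcell] using hSP T Eint Eext M g
  set E := M.energy f / ζ with hE
  have hE0 : 0 ≤ E := div_nonneg (M.energy_nonneg f) hζ.le
  obtain ⟨c, hc⟩ := hSP' f
  set X := ∑ K, M.area K * (f K - c) ^ 2 with hX
  have hX0 : 0 ≤ X := Finset.sum_nonneg fun K _ => mul_nonneg (M.area_nonneg K) (sq_nonneg _)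
  have hXE : X ≤ C₂ * E := by
    calc X ≤ _ := hc
      _ ≤ C₀ * (2 * m * E) :=
          mul_le_mul_of_nonneg_left (hreg.variation_sq_le hζ hΩ.isOpen hΩ.isBounded f) hC₀
      _ = C₂ * E := by rw [hC₂]; ring
  refine ⟨c, hXE, ?_⟩
  obtain ⟨c', hc'⟩ := hSP' fun K => (f K - c) ^ 2
  have harea : ∑ K, M.area K = m := M.sum_area hΩ.isOpen hΩ.isBounded
  -- decomposition of the `L²` norm of `(f - c) ^ 2` into variance and squared mean
  have hvar : ∑ K, M.area K * (f K - c) ^ 4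
      ≤ ∑ K, M.area K * ((f K - c) ^ 2 - c') ^ 2 + X ^ 2 / m := by
    have e : ∑ K, M.area K * ((f K - c) ^ 2 - c') ^ 2
        = ∑ K, M.area K * (f K - c) ^ 4 - 2 * c' * X + c' ^ 2 * m := by
      calc ∑ K, M.area K * ((f K - c) ^ 2 - c') ^ 2
          = ∑ K, (M.area K * (f K - c) ^ 4 - 2 * c' * (M.area K * (f K - c) ^ 2)
              + c' ^ 2 * M.area K) := Finset.sum_congr rfl fun K _ => by ring
        _ = _ := by
            rw [Finset.sum_add_distrib, Finset.sum_sub_distrib, ← Finset.mul_sum,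
              ← Finset.mul_sum, harea]
    have h2 : 0 ≤ X ^ 2 / m - 2 * c' * X + c' ^ 2 * m := by
      have : X ^ 2 / m - 2 * c' * X + c' ^ 2 * m = (X - c' * m) ^ 2 / m := by
        field_simp
        ring
      rw [this]
      positivity
    linarith
  calc ∑ K, M.area K * (f K - c) ^ 4
      ≤ _ := hvar
    _ ≤ C₀ * (8 * E * (C₂ * E)) + (C₂ * E) ^ 2 / m := by
        gcongr
        refine hc'.trans (mul_le_mul_of_nonneg_left ?_ hC₀)
        exact (hreg.variation_sq_sub_le hζ hΩ.isOpen hΩ.isBounded f c).trans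
          (mul_le_mul_of_nonneg_left hXE (by positivity))
    _ = _ := by ring

theorem theorem5p1 (Ω : Set Plane) (hΩ : IsPolygonalDomain Ω) :
    ∃ C_PW C_B C_LS : ℝ, 0 < C_PW ∧ 0 < C_B ∧ 0 < C_LS ∧ C_B = C_PW ∧
      ∀ (T Eint Eext : Type) [Fintype T] [Fintype Eint] [Fintype Eext]
        (M : PolygonalMesh Ω T Eint Eext) (ζ : ℝ), 0 < ζ → M.IsRegular ζ →
      ∀ μ : T → ℝ, M.IsDensity μ →
        (∀ f : T → ℝ,
          ∑ K, M.area K * |f K - M.mean μ f| ^ 2 * μ K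
            ≤ C_PW / ζ * (⨆ K, μ K) * M.energy f) ∧
        (∀ p : ℝ, 1 < p → p ≤ 2 → ∀ f : T → ℝ, (∀ K, 0 ≤ f K) →
          ∑ K, M.area K * f K ^ 2 * μ K - (∑ K, M.area K * f K ^ (2 / p) * μ K) ^ p
            ≤ C_B / ζ * (⨆ K, μ K) * M.energy f) ∧
        (∀ f : T → ℝ, (∀ K, 0 < f K) →
          ∑ K, M.area K * f K ^ 2 *
              Real.log (f K ^ 2 / ∑ K', M.area K' * f K' ^ 2 * μ K') * μ K
            ≤ C_LS / ζ ^ 2 * √(⨆ K, μ K) * M.energy f) := by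
  obtain ⟨C₂, C₄, hC₂, hC₄, H⟩ := hΩ.exists_sum_area_le
  refine ⟨C₂ + 1, C₂ + 1, 10 * √C₄ + 1, by positivity, by positivity, by positivity, rfl, ?_⟩
  intro T Eint Eext _ _ _ M ζ hζ hreg μ hμ
  set w : T → ℝ := fun K => M.area K * μ K with hw
  have hw0 : ∀ K, 0 ≤ w K := fun K => mul_nonneg (M.area_nonneg K) (hμ.nonneg K)
  have hw1 : ∑ K, w K = 1 := hμ.mass
  set S := ⨆ K, μ K with hS
  have hμS : ∀ K, μ K ≤ S := fun K => le_ciSup (Set.finite_range μ).bddAbove K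
  have hS0 : 0 ≤ S := Real.iSup_nonneg hμ.nonneg
  -- the density is removed at the price of its supremum
  have hdens : ∀ g : T → ℝ, (∀ K, 0 ≤ g K) → ∑ K, w K * g K ≤ S * ∑ K, M.area K * g K := by
    intro g hg
    rw [Finset.mul_sum]
    refine Finset.sum_le_sum fun K _ => ?_
    have h := mul_le_mul_of_nonneg_right (hμS K) (mul_nonneg (M.area_nonneg K) (hg K))
    calc w K * g K = μ K * (M.area K * g K) := by rw [hw]; ring
      _ ≤ _ := h
  have hvar : ∀ f : T → ℝ, ∑ K, w K * (f K - ∑ K', w K' * f K') ^ 2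
      ≤ (C₂ + 1) / ζ * S * M.energy f := by
    intro f
    obtain ⟨c, hc, -⟩ := H T Eint Eext M ζ hζ hreg f
    have hE0 : 0 ≤ M.energy f / ζ := div_nonneg (M.energy_nonneg f) hζ.le
    calc ∑ K, w K * (f K - ∑ K', w K' * f K') ^ 2
        ≤ ∑ K, w K * (f K - c) ^ 2 := sum_mul_sq_sub_sum_le hw1 f c
      _ ≤ S * ∑ K, M.area K * (f K - c) ^ 2 := hdens _ fun K => sq_nonneg _
      _ ≤ S * ((C₂ + 1) * (M.energy f / ζ)) := by
          refine mul_le_mul_of_nonneg_left (hc.trans ?_) hS0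
          linarith
      _ = _ := by ring
  refine ⟨fun f => ?_, fun p hp1 hp2 f hf => ?_, fun f hf => ?_⟩
  · refine (le_of_eq ?_).trans (hvar f)
    have hmean : M.mean μ f = ∑ K', w K' * f K' :=
      Finset.sum_congr rfl fun K _ => by rw [hw]; ring
    refine Finset.sum_congr rfl fun K _ => ?_
    rw [sq_abs, hmean, hw]
    ring
  · refine (le_of_eq ?_).trans ((sum_sub_sum_rpow_le hw0 hw1 hp1 hp2 hf).trans (hvar f))
    have e : ∀ g : T → ℝ, ∑ K, M.area K * g K * μ K = ∑ K, w K * g K := fun g =>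
      Finset.sum_congr rfl fun K _ => by rw [hw]; ring
    rw [e fun K => f K ^ 2, e fun K => f K ^ (2 / p)]
  · obtain ⟨c, -, hc⟩ := H T Eint Eext M ζ hζ hreg f
    have hE0 : 0 ≤ M.energy f / ζ := div_nonneg (M.energy_nonneg f) hζ.le
    have hL4 : √(∑ K, w K * (f K - c) ^ 4) ≤ √S * (√C₄ * (M.energy f / ζ)) := by
      calc √(∑ K, w K * (f K - c) ^ 4) ≤ √(S * (C₄ * (M.energy f / ζ) ^ 2)) := by
            apply Real.sqrt_le_sqrt
            exact (hdens _ fun K => by positivity).trans (mul_le_mul_of_nonneg_left hc hS0)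
        _ = √S * (√C₄ * (M.energy f / ζ)) := by
            rw [Real.sqrt_mul hS0, Real.sqrt_mul hC₄, Real.sqrt_sq hE0]
    have hEζ : M.energy f / ζ ≤ M.energy f / ζ ^ 2 := by
      rcases isEmpty_or_nonempty Eint with hempty | ⟨⟨σ⟩⟩
      · simp [PolygonalMesh.energy]
      · have h1 := hreg.le_one hζ hΩ.isOpen σ
        have h2 : ζ ^ 2 ≤ ζ := by nlinarith
        exact div_le_div_of_nonneg_left (M.energy_nonneg f) (by positivity) h2
    have e1 : ∑ K', M.area K' * f K' ^ 2 * μ K' = ∑ K', w K' * f K' ^ 2 :=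
      Finset.sum_congr rfl fun K _ => by rw [hw]; ring
    rw [e1]
    calc ∑ K, M.area K * f K ^ 2 * Real.log (f K ^ 2 / ∑ K', w K' * f K' ^ 2) * μ K
        = ∑ K, w K * (f K ^ 2 * Real.log (f K ^ 2 / ∑ K', w K' * f K' ^ 2)) :=
          Finset.sum_congr rfl fun K _ => by rw [hw]; ring
      _ ≤ 10 * √(∑ K, w K * (f K - c) ^ 4) := entropy_le_sqrt_sum_pow_four hw0 hw1 hf c
      _ ≤ 10 * (√S * (√C₄ * (M.energy f / ζ ^ 2))) := by
          refine mul_le_mul_of_nonneg_left (hL4.trans ?_) (by norm_num)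
          gcongr
      _ ≤ 10 * (√S * (√C₄ * (M.energy f / ζ ^ 2))) + √S * (M.energy f / ζ ^ 2) :=
          le_add_of_nonneg_right (mul_nonneg (Real.sqrt_nonneg _) (hE0.trans hEζ))
      _ = _ := by ring
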